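/- Let $K$ be a number field with algebraic closure $\overline{K}$, let $c\in K$ with $c\neq 0$, let $\mathcal{E}_2$ be the elliptic curve $y^2=x^3+c$, and let $K_7=K(\mathcal{E}_2[7])$ be the field generated over $K$ by the coordinates of the points of $\mathcal{E}_2(\overline{K})$ killed by $7$. Let $\zeta_3,\zeta_7\in\overline{K}$ be primitive third and seventh roots of unity and put $$\delta_1=-\big((-132\zeta_3-120)\zeta_7^5+(-168\zeta_3-12)\zeta_7^4+(-24\zeta_3+60)\zeta_7^3+(-60\zeta_3-84)\zeta_7^2+(-192\zeta_3-96)\zeta_7-96\zeta_3+52\big).$$ Let $\sqrt[3]{\delta_1c}$ and $\sqrt{(\delta_1+1)c}$ be any cube root of $\delta_1c$ and any square root of $(\delta_1+1)c$ in $\overline{K}$. Consider the conditions - **A**: $\zeta_3\notin K$; - **B1**: $\zeta_7+\zeta_7^{-1}\notin K(\zeta_3)$; - **B2**: $\zeta_7\notin K(\zeta_3,\zeta_7+\zeta_7^{-1})$; - **C**: $\sqrt[3]{\delta_1c}\notin K(\zeta_3,\zeta_7)$; - **D**: $\sqrt{(\delta_1+1)c}\notin K(\zeta_3,\zeta_7)$.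 Then $d=[K_7:K]$ is one of $72,36,24,18,12,9,8,6,4,3,2,1$, and each of these values occurs for some number field $K$ and some nonzero $c\in K$. Moreover $d$ is determined by the conditions as follows, where in each row exactly the listed conditions hold and the others fail ("one of" and "two of" mean exactly one and exactly two), and $d$ has the stated value if and only if the conditions that hold are as described in its row: - $d=72$: A, B1, B2, C, D; - $d=36$: B1, C and two of A, B2, D; - $d=24$: one of B1, C, and A, B2, D; - $d=18$: B1, C and one of A, B2, D; - $d=12$: one of B1, C and two of A, B2, D; - $d=9$: B1, C; - $d=8$: A, B2, D; - $d=6$: one of B1, C and one of A, B2, D; - $d=4$: two of A, B2, D; - $d=3$: one of B1, C; - $d=2$: one of A, B2, D; - $d=1$: no condition holds. -/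

import Mathlib

open IntermediateField

noncomputable section

/-- The curve `y² = x³ + c`. It is an elliptic curve (in characteristic `0`) exactly if `c ≠ 0`. -/
def mordellCurve {K : Type*} [Field K] (c : K) : WeierstrassCurve K where
  a₁ := 0
  a₂ := 0
  a₃ := 0
  a₄ := 0
  a₆ := c

open Classical in
/-- The `m`-th division field `K(E[m])` inside the algebraic closure of `K`: the field generated
over `K` by the coordinates of all (affine) points of `E` over the algebraic closure that are
killed by `m`. The point at infinity has no affine coordinates and contributes nothing. -/
def divisionField {K : Type*} [Field K] (E : WeierstrassCurve K) (m : ℕ) :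
    IntermediateField K (AlgebraicClosure K) :=
  adjoin K {z | ∃ (x y : AlgebraicClosure K)
    (h : (E.baseChange (AlgebraicClosure K)).toAffine.Nonsingular x y),
    m • WeierstrassCurve.Affine.Point.some x y h = 0 ∧ (z = x ∨ z = y)}

/-- The number `δ₁` attached to a primitive cube root of unity `ζ₃` and a primitive seventh root
of unity `ζ₇`. -/
def delta₁ {F : Type*} [CommRing F] (ζ₃ ζ₇ : F) : F :=
  -((-132 * ζ₃ - 120) * ζ₇ ^ 5 + (-168 * ζ₃ - 12) * ζ₇ ^ 4 + (-24 * ζ₃ + 60) * ζ₇ ^ 3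
    + (-60 * ζ₃ - 84) * ζ₇ ^ 2 + (-192 * ζ₃ - 96) * ζ₇ - 96 * ζ₃ + 52)

section Conditions

variable (K : Type*) [Field K] (ζ₃ ζ₇ : AlgebraicClosure K)

/-- Condition A: `ζ₃ ∉ K`. -/
def CondA : Prop := ζ₃ ∉ (⊥ : IntermediateField K (AlgebraicClosure K))

/-- Condition B1: `ζ₇ + ζ₇⁻¹ ∉ K(ζ₃)`. -/
def CondB1 : Prop := ζ₇ + ζ₇⁻¹ ∉ adjoin K {ζ₃}

/-- Condition B2: `ζ₇ ∉ K(ζ₃, ζ₇ + ζ₇⁻¹)`. -/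
def CondB2 : Prop := ζ₇ ∉ adjoin K {ζ₃, ζ₇ + ζ₇⁻¹}

/-- Condition C, for a cube root `r` of `δ₁ c`: `r ∉ K(ζ₃, ζ₇)`. -/
def CondC (r : AlgebraicClosure K) : Prop := r ∉ adjoin K {ζ₃, ζ₇}

/-- Condition D, for a square root `s` of `(δ₁ + 1) c`: `s ∉ K(ζ₃, ζ₇)`. -/
def CondD (s : AlgebraicClosure K) : Prop := s ∉ adjoin K {ζ₃, ζ₇}

end Conditions

/-- Exactly one of two conditions holds. -/
def OneOfTwo (P Q : Prop) : Prop := (P ∧ ¬Q) ∨ (¬P ∧ Q)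

/-- Exactly one of three conditions holds. -/
def OneOfThree (P Q R : Prop) : Prop := (P ∧ ¬Q ∧ ¬R) ∨ (¬P ∧ Q ∧ ¬R) ∨ (¬P ∧ ¬Q ∧ R)

/-- Exactly two of three conditions hold. -/
def TwoOfThree (P Q R : Prop) : Prop := (P ∧ Q ∧ ¬R) ∨ (P ∧ ¬Q ∧ R) ∨ (¬P ∧ Q ∧ R)

/-- None of three conditions holds. -/
def NoneOfThree (P Q R : Prop) : Prop := ¬P ∧ ¬Q ∧ ¬R

/-- The table of degrees: each row says which of the five conditions hold (the others failing)
precisely when the degree is `d`. -/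
def DegreeTable (A B1 B2 C D : Prop) (d : ℕ) : Prop :=
  (d = 72 ↔ A ∧ B1 ∧ B2 ∧ C ∧ D) ∧
  (d = 36 ↔ (B1 ∧ C) ∧ TwoOfThree A B2 D) ∧
  (d = 24 ↔ OneOfTwo B1 C ∧ A ∧ B2 ∧ D) ∧
  (d = 18 ↔ (B1 ∧ C) ∧ OneOfThree A B2 D) ∧
  (d = 12 ↔ OneOfTwo B1 C ∧ TwoOfThree A B2 D) ∧
  (d = 9 ↔ (B1 ∧ C) ∧ NoneOfThree A B2 D) ∧
  (d = 8 ↔ (¬B1 ∧ ¬C) ∧ A ∧ B2 ∧ D) ∧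
  (d = 6 ↔ OneOfTwo B1 C ∧ OneOfThree A B2 D) ∧
  (d = 4 ↔ (¬B1 ∧ ¬C) ∧ TwoOfThree A B2 D) ∧
  (d = 3 ↔ OneOfTwo B1 C ∧ NoneOfThree A B2 D) ∧
  (d = 2 ↔ (¬B1 ∧ ¬C) ∧ OneOfThree A B2 D) ∧
  (d = 1 ↔ (¬B1 ∧ ¬C) ∧ NoneOfThree A B2 D)

/-- The twelve degrees. -/
def possibleDegrees : Finset ℕ := {72, 36, 24, 18, 12, 9, 8, 6, 4, 3, 2, 1}

end

/-! On `y² = x³ + c` the 48 points of order 7 form eight orbits under multiplication of `x` by cube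
roots of unity and of `y` by signs, and `T = x³ / c` determines the orbit. The relation `P + 2P =
-4P` makes `T` a root of a polynomial of degree 8: a quadratic that splits over `ℚ(ζ₃)` times a
sextic with roots `δ₁(ζ₃, ζ₇ ^ k)` (`torsion_root`, `prod_six_sub_delta`).

Inside `ℚ(ζ₃, ζ₇)` every root `T` is `δ₁` times a cube while `T + 1` is `δ₁ + 1` times a square
(`deltaEquiv_of_root`). Since `x³ = T c` and `y² = (T + 1) c`, all coordinates lie in `K(ζ₃, ζ₇, r,
s)`, with `r` and `s` the two radicals. Conversely `(r, s)` is a point killed by 7: doubling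
replaces the parameter `ζ₇` by `ζ₇ ^ 4`, three doublings restore it, and in fact `8P = P`
(`seven_smul_eq_zero`). As `ζ₃` and `ζ₇` can be recovered from coordinates of torsion points, the
two fields agree (`divisionField_seven_eq`).

The degree is then read off a tower in which each of the five conditions says whether one step of
degree 2 or 3 is proper. So `d = 2 ^ i * 3 ^ j`, where `i` counts the valid conditions among A, B2,
D and `j` those among B1, C; unique factorization gives the table.

For existence, `K` runs through subfields of `ℚ(ζ₂₁)`, where `K(ζ₃, ζ₇) = ℚ(ζ₂₁)`. The degree is
`[ℚ(ζ₂₁) : K]` times 1, 2, 3 or 6, and this factor is controlled by powers of 3 in `c`, because 3 is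
neither a square nor a cube in `ℚ(ζ₂₁)` (`cyclotomic_pow_ne_three`). -/

noncomputable section

/-! ### Explicit elements of `ℚ(ζ₃, ζ₇)` and the identities between them. -/

/-- The ratio `x(2P) / x(P)` for a point with `x³ = δ₁ c`. -/
def dblX {F : Type*} [Field F] (w z : F) : F :=
  (1 + z^2 + z^3 - z^4 + 2*z^5) + (- z^2 + 2*z^3 - 2*z^4 + z^5) * w

/-- The ratio `y(2P) / y(P)` for a point with `x³ = δ₁ c`. -/
def dblY {F : Type*} [Field F] (w z : F) : F :=
  (- 15 - 4*z - 8*z^2 - 10*z^3 - 4*z^4 - 14*z^5) + (- 4 - 8*z + 2*z^2 - 10*z^3 + 2*z^4 - 10*z^5) *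
      w

/-- A cube root of `δ₁(ζ₃, ζ₇⁻¹) / δ₁(ζ₃, ζ₇)`. -/
def conjX {F : Type*} [Field F] (w z : F) : F :=
  (2 + 2*z - z^2 + 2*z^3 + 3*z^4) + (2 + 4*z + z^2 + z^3 + 3*z^4 + 3*z^5) * w

/-- A square root of `(δ₁(ζ₃, ζ₇⁻¹) + 1) / (δ₁(ζ₃, ζ₇) + 1)`. -/
def conjY {F : Type*} [Field F] (w z : F) : F :=
  (- 1 - 8*z - 4*z^2 + 2*z^3 - 6*z^4 - 8*z^5) + (6 - 4*z^2 + 4*z^3 + 4*z^4 - 4*z^5) * w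

/-- A cube root of `(12 ζ₃ + 8) / 7 / δ₁`. -/
def ramX {F : Type*} [Field F] (w z : F) : F :=
  ((- 7 - 5*z - z^2 - 9*z^3 - z^4 - 5*z^5) + (- 7 - 4*z - 5*z^2 - 3*z^3 - 5*z^4 - 4*z^5) * w) / 7

/-- A square root of `((12 ζ₃ + 8) / 7 + 1) / (δ₁ + 1)`. -/
def ramY {F : Type*} [Field F] (w z : F) : F :=
  ((- 1 - 4*z + 4*z^2 - 6*z^3) + (2 - 6*z + 6*z^2 - 2*z^3) * w) / 7

/-- A cube root of `(-12 ζ₃ - 4) / 7 / δ₁`. -/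
def ramX' {F : Type*} [Field F] (w z : F) : F :=
  ((1 + z + 5*z^3 - 5*z^4 + 5*z^5) + (3 - 4*z + z^3 - z^4 + z^5) * w) / 7

/-- A square root of `((-12 ζ₃ - 4) / 7 + 1) / (δ₁ + 1)`. -/
def ramY' {F : Type*} [Field F] (w z : F) : F :=
  ((- 5 - 2*z - 2*z^2 - 2*z^3 - 6*z^4 - 4*z^5) + (- 8 - 6*z - 6*z^2 - 6*z^3 - 4*z^4 - 12*z^5) * w)
      / 7

/-- The duplication formula gives `x(2P) / x(P) = (T - 8) / (4 (T + 1))` with `T = x³ / c`; this is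
the case `T = δ₁`. Here and below, the coefficients of `hw` and `hz` are the quotients left by
reduction modulo the third and seventh cyclotomic polynomials. -/
theorem delta_sub_eight {F : Type*} [Field F] [CharZero F] {w z : F} (hw : w ^ 2 + w + 1 = 0)
    (hz : z ^ 6 + z ^ 5 + z ^ 4 + z ^ 3 + z ^ 2 + z + 1 = 0) :
    delta₁ w z - 8 = 4 * (delta₁ w z + 1) * dblX w z := by
  simp only [delta₁, dblX]
  linear_combination (- 1056 + 576*z^2 - 720*z^3 - 720*z^4 + 576*z^5) * hw
    + (1200 - 1488*z - 336*z^2 + 1344*z^3 - 960*z^4 + 768*w - 1344*w*z - 768*w*z^2 + 1632*w*z^3 -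
      1536*w*z^4 + 1056*w^2 - 1056*w^2*z - 192*w^2*z^2 + 912*w^2*z^3 - 528*w^2*z^4) * hz

/-- The duplication formula for `y`: the ratio `y(2P) / y(P)` is `(T² + 20 T - 8) / (8 (T + 1)²)`,
taken at `T = δ₁`. -/
theorem delta_sq_add {F : Type*} [Field F] [CharZero F] {w z : F} (hw : w ^ 2 + w + 1 = 0)
    (hz : z ^ 6 + z ^ 5 + z ^ 4 + z ^ 3 + z ^ 2 + z + 1 = 0) :
    delta₁ w z ^ 2 + 20 * delta₁ w z - 8 = 8 * (delta₁ w z + 1) ^ 2 * dblY w z := by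
  simp only [delta₁, dblY]
  linear_combination (513504 - 884736*z - 775872*z^2 + 573840*z^3 - 135792*z^4 - 1169856*z^5 -
      884736*w - 1769472*w*z - 490752*w*z^2 - 175104*w*z^3 - 1594368*w*z^4 - 1278720*w*z^5) * hw
    + (- 199728 - 15408*z + 924048*z^2 + 1010304*z^3 - 2218176*z^4 + 520704*z^5 + 3144960*z^6 -
      1135872*z^7 - 829440*z^8 + 1612800*z^9 - 728640*w + 2786688*w*z + 3570048*w*z^2 -
      658656*w*z^3 - 2086848*w*z^4 + 7642368*w*z^5 + 5727744*w*z^6 - 2670336*w*z^7 + 1184256*w*z^8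
      + 4700160*w*z^9 + 1173024*w^2 + 5573088*w^2*z + 3727296*w^2*z^2 + 306864*w^2*z^3 +
      4109328*w^2*z^4 + 10483200*w^2*z^5 + 4836096*w^2*z^6 - 458496*w^2*z^7 + 4011264*w^2*z^8 +
      4485888*w^2*z^9 + 1179648*w^3 + 2359296*w^3*z + 711936*w^3*z^2 + 52992*w^3*z^3 +
      2529792*w^3*z^4 + 3873024*w^3*z^5 + 1179648*w^3*z^6 + 179712*w^3*z^7 + 1875456*w^3*z^8 +
      1393920*w^3*z^9) * hz

/-- Cubing the ratio of `x`-coordinates: doubling moves the parameter from `z` to `z ^ 4`. -/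
theorem delta_pow_four {F : Type*} [Field F] [CharZero F] {w z : F} (hw : w ^ 2 + w + 1 = 0)
    (hz : z ^ 6 + z ^ 5 + z ^ 4 + z ^ 3 + z ^ 2 + z + 1 = 0) :
    delta₁ w (z ^ 4) = delta₁ w z * dblX w z ^ 3 := by
  simp only [delta₁, dblX]
  linear_combination (- 1264 - 1520*z - 360*z^2 - 496*z^3 - 1600*z^4 - 1088*z^5 - 116*w - 3040*w*z
      - 1476*w*z^2 + 532*w*z^3 - 1676*w*z^4 - 2932*w*z^5 + 1404*w^2 - 684*w^2*z^2 + 948*w^2*z^3 +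
      948*w^2*z^4 - 684*w^2*z^5) * hw
    + (1264 + 160*z - 992*z^2 - 8*z^3 + 720*z^4 + 376*z^5 - 2632*z^6 + 1632*z^7 + 1432*z^8 -
      4552*z^9 + 3192*z^10 + 48*z^11 - 2880*z^12 + 2184*z^13 - 840*z^14 + 1380*w + 2988*w*z -
      3036*w*z^2 - 1656*w*z^3 + 1920*w*z^4 + 1824*w*z^5 - 5412*w*z^6 - 1764*w*z^7 + 9696*w*z^8 -
      12456*w*z^9 + 2424*w*z^10 + 7152*w*z^11 - 11376*w*z^12 + 6780*w*z^13 - 2364*w*z^14 - 24*w^2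
      + 4584*w^2*z - 1752*w^2*z^2 - 3792*w^2*z^3 + 3648*w^2*z^4 + 2280*w^2*z^5 - 3576*w^2*z^6 -
      3384*w^2*z^7 + 10704*w^2*z^8 - 7464*w^2*z^9 - 5112*w^2*z^10 + 15192*w^2*z^11 -
      15336*w^2*z^12 + 8208*w^2*z^13 - 2304*w^2*z^14 - 1288*w^3 + 4328*w^3*z - 880*w^3*z^2 -
      3640*w^3*z^3 + 1920*w^3*z^4 + 3752*w^3*z^5 - 4712*w^3*z^6 - 1152*w^3*z^7 + 5768*w^3*z^8 -
      1976*w^3*z^9 - 6672*w^3*z^10 + 11472*w^3*z^11 - 9216*w^3*z^12 + 4176*w^3*z^13 - 912*w^3*z^14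
      - 1404*w^4 + 1404*w^4*z + 684*w^4*z^2 - 1632*w^4*z^3 + 1632*w^4*z^5 - 588*w^4*z^6 -
      1884*w^4*z^7 + 2424*w^4*z^8 - 192*w^4*z^9 - 2400*w^4*z^10 + 3072*w^4*z^11 - 2016*w^4*z^12 +
      756*w^4*z^13 - 132*w^4*z^14) * hz

theorem delta_pow_four_add_one {F : Type*} [Field F] [CharZero F] {w z : F} (hw : w ^ 2 + w + 1 = 0)
    (hz : z ^ 6 + z ^ 5 + z ^ 4 + z ^ 3 + z ^ 2 + z + 1 = 0) :
    delta₁ w (z ^ 4) + 1 = (delta₁ w z + 1) * dblY w z ^ 2 := by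
  simp only [delta₁, dblY]
  linear_combination (1452 + 1152*z - 588*z^2 + 744*z^3 + 1848*z^4 - 156*z^5 + 1152*w + 2304*w*z +
      720*w*z^2 + 48*w*z^3 + 2256*w*z^4 + 1584*w*z^5) * hw
    + (9972 - 26604*z - 144*z^2 + 13440*z^3 - 36900*z^4 + 2604*z^5 - 24852*z^6 - 9192*z^7 +
      7728*z^8 - 23532*z^9 + 12*z^10 - 120*z^13 + 120*z^14 - 17988*w - 37836*w*z - 38148*w*z^2 -
      600*w*z^3 - 89496*w*z^4 - 47256*w*z^5 - 47580*w*z^6 - 47676*w*z^7 + 5520*w*z^8 - 59640*w*z^9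
      + 168*w*z^10 - 132*w*z^13 + 132*w*z^14 - 13308*w^2 - 37572*w^2*z - 20244*w^2*z^2 -
      15732*w^2*z^3 - 57204*w^2*z^4 - 57936*w^2*z^5 - 27984*w^2*z^6 - 43392*w^2*z^7 + 2352*w^2*z^8
      - 48960*w^2*z^9 - 2688*w^3 - 8832*w^3*z - 7056*w^3*z^2 + 480*w^3*z^3 - 14688*w^3*z^4 -
      14880*w^3*z^5 - 6144*w^3*z^6 - 11088*w^3*z^7 + 1680*w^3*z^8 - 13200*w^3*z^9) * hz

/-- Since 4 has order 3 modulo 7, three doublings return to the parameter `z`; that the product of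
the ratios is exactly 1, not another cube root of unity, is what yields `8P = P`. -/
theorem dblX_mul {F : Type*} [Field F] [CharZero F] {w z : F} (hw : w ^ 2 + w + 1 = 0)
    (hz : z ^ 6 + z ^ 5 + z ^ 4 + z ^ 3 + z ^ 2 + z + 1 = 0) :
    dblX w z * dblX w (z ^ 4) * dblX w (z ^ 2) = 1 := by
  simp only [dblX]
  linear_combination (- 3 + z + z^2 + z^4 + w + 2*w*z + 2*w*z^2 + 2*w*z^4) * hw
    + (3 - 4*z + z^2 + z^3 - 2*z^4 + 3*z^5 + 2*z^7 - 5*z^8 + 4*z^9 - z^10 - z^11 + 5*z^12 - 2*z^13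
      + z^14 - 4*z^16 + 6*z^17 - 5*z^18 + 5*z^19 + z^20 - 2*z^21 - 3*z^22 + 4*z^23 + 4*z^24 -
      8*z^25 + 6*z^26 + 4*z^27 - 12*z^28 + 8*z^29 + 2*w - 5*w*z - w*z^2 + 6*w*z^3 - 8*w*z^4 +
      7*w*z^5 - w*z^6 + 3*w*z^7 - 9*w*z^8 + 5*w*z^9 - 3*w*z^10 + 7*w*z^12 - 4*w*z^13 - 2*w*z^14 +
      5*w*z^15 - 9*w*z^16 + 8*w*z^17 - 6*w*z^18 + 7*w*z^19 - 3*w*z^20 + 2*w*z^21 - 11*w*z^22 +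
      8*w*z^23 + 10*w*z^24 - 18*w*z^25 + 9*w*z^26 + 12*w*z^27 - 24*w*z^28 + 12*w*z^29 + 2*w^2 -
      5*w^2*z + 3*w^2*z^3 - 3*w^2*z^4 + 3*w^2*z^5 + w^2*z^6 - w^2*z^7 - 3*w^2*z^8 + 3*w^2*z^9 -
      w^2*z^10 - 6*w^2*z^11 + 13*w^2*z^12 - 6*w^2*z^13 - 3*w^2*z^14 + 2*w^2*z^15 - 3*w^2*z^16 +
      5*w^2*z^17 - 3*w^2*z^18 + w^2*z^19 + 3*w^2*z^20 + 2*w^2*z^21 - 14*w^2*z^22 + 5*w^2*z^23 +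
      16*w^2*z^24 - 21*w^2*z^25 + 9*w^2*z^26 + 9*w^2*z^27 - 15*w^2*z^28 + 6*w^2*z^29 - w^3 - w^3*z
      + 2*w^3*z^3 - 2*w^3*z^4 + 2*w^3*z^5 - w^3*z^7 - w^3*z^8 + 2*w^3*z^10 - 2*w^3*z^11 +
      2*w^3*z^12 - 2*w^3*z^14 + 2*w^3*z^15 - 2*w^3*z^16 - w^3*z^17 + 5*w^3*z^18 - 4*w^3*z^19 -
      w^3*z^20 + 7*w^3*z^21 - 8*w^3*z^22 + w^3*z^23 + 6*w^3*z^24 - 7*w^3*z^25 + 3*w^3*z^26 +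
      2*w^3*z^27 - 3*w^3*z^28 + w^3*z^29) * hz

theorem dblY_mul {F : Type*} [Field F] [CharZero F] {w z : F} (hw : w ^ 2 + w + 1 = 0)
    (hz : z ^ 6 + z ^ 5 + z ^ 4 + z ^ 3 + z ^ 2 + z + 1 = 0) :
    dblY w z * dblY w (z ^ 4) * dblY w (z ^ 2) = 1 := by
  simp only [dblY]
  linear_combination (4 + 8*z + 8*z^2 + 8*z^4 + 8*w + 16*w*z + 16*w*z^2 + 16*w*z^4) * hw
    + (- 3380 + 2472*z - 1800*z^2 + 218*z^3 - 1598*z^4 - 382*z^5 + 300*z^6 - 2514*z^7 + 548*z^8 -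
      1600*z^9 - 1344*z^10 - 580*z^11 - 1364*z^12 + 146*z^13 - 1414*z^14 - 796*z^15 + 444*z^16 -
      2104*z^17 - 412*z^18 - 960*z^19 - 1500*z^20 - 488*z^21 - 1688*z^22 + 196*z^23 - 84*z^24 -
      2296*z^25 + 952*z^26 - 1960*z^27 + 1960*z^28 - 2744*z^29 - 2712*w + 408*w*z - 510*w*z^2 -
      1660*w*z^3 + 662*w*z^4 - 4070*w*z^5 + 2240*w*z^6 - 5098*w*z^7 + 5036*w*z^8 - 6914*w*z^9 +
      674*w*z^10 - 3428*w*z^11 + 1596*w*z^12 - 3810*w*z^13 - 798*w*z^14 - 2344*w*z^15 +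
      4520*w*z^16 - 7128*w*z^17 + 2104*w*z^18 - 3820*w*z^19 + 1812*w*z^20 - 5276*w*z^21 -
      1036*w*z^22 - 1176*w*z^23 + 3272*w*z^24 - 7072*w*z^25 + 3704*w*z^26 - 4760*w*z^27 +
      5152*w*z^28 - 5880*w*z^29 - 732*w^2 - 316*w^2*z + 112*w^2*z^2 - 1640*w^2*z^3 + 1832*w^2*z^4
      - 3560*w^2*z^5 + 1956*w^2*z^6 - 4260*w^2*z^7 + 5720*w^2*z^8 - 5568*w^2*z^9 + 1228*w^2*z^10 -
      3104*w^2*z^11 + 3028*w^2*z^12 - 3464*w^2*z^13 - 780*w^2*z^14 - 1932*w^2*z^15 + 5092*w^2*z^16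
      - 5852*w^2*z^17 + 2184*w^2*z^18 - 2972*w^2*z^19 + 3272*w^2*z^20 - 4788*w^2*z^21 -
      476*w^2*z^22 - 1220*w^2*z^23 + 3948*w^2*z^24 - 6064*w^2*z^25 + 3504*w^2*z^26 - 3800*w^2*z^27
      + 4360*w^2*z^28 - 4200*w^2*z^29 - 72*w^3 - 72*w^3*z + 32*w^3*z^2 - 304*w^3*z^3 + 400*w^3*z^4
      - 656*w^3*z^5 + 368*w^3*z^6 - 1160*w^3*z^7 + 1704*w^3*z^8 - 1376*w^3*z^9 + 448*w^3*z^10 -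
      880*w^3*z^11 + 928*w^3*z^12 - 608*w^3*z^13 - 512*w^3*z^14 - 440*w^3*z^15 + 1496*w^3*z^16 -
      1472*w^3*z^17 + 584*w^3*z^18 - 720*w^3*z^19 + 1048*w^3*z^20 - 1088*w^3*z^21 - 312*w^3*z^22 -
      200*w^3*z^23 + 1120*w^3*z^24 - 1560*w^3*z^25 + 960*w^3*z^26 - 1000*w^3*z^27 + 1200*w^3*z^28
      - 1000*w^3*z^29) * hz

theorem delta_pow_six {F : Type*} [Field F] [CharZero F] {w z : F} (hw : w ^ 2 + w + 1 = 0)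
    (hz : z ^ 6 + z ^ 5 + z ^ 4 + z ^ 3 + z ^ 2 + z + 1 = 0) :
    delta₁ w (z ^ 6) = delta₁ w z * conjX w z ^ 3 := by
  simp only [delta₁, conjX]
  linear_combination (36428 + 41500*z + 2808*z^2 + 14952*z^3 + 48232*z^4 + 21280*z^5 + 12160*w +
      83000*w*z + 39312*w*z^2 - 12084*w*z^3 + 54476*w*z^4 + 76256*w*z^5 - 29340*w^2 +
      16284*w^2*z^2 - 20304*w^2*z^3 - 20304*w^2*z^4 + 16284*w^2*z^5) * hw
    + (- 36064 - 4956*z + 35860*z^2 - 12064*z^3 - 27384*z^4 + 18696*z^5 + 9372*z^6 - 19404*z^7 -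
      2148*z^8 + 6576*z^9 - 3456*z^10 - 3168*z^11 - 60*z^12 - 120*z^16 + 108*z^17 + 12*z^18 -
      120*z^23 + 120*z^24 - 48012*w - 77640*w*z + 71676*w*z^2 + 32532*w*z^3 - 90120*w*z^4 -
      17508*w*z^5 + 47148*w*z^6 - 29916*w*z^7 - 51960*w*z^8 + 1164*w*z^9 + 4068*w*z^10 -
      17352*w*z^11 - 9696*w*z^12 - 132*w*z^16 - 36*w*z^17 + 168*w*z^18 - 132*w*z^23 + 132*w*z^24 -
      20304*w^2 - 114084*w^2*z + 42816*w^2*z^2 + 56688*w^2*z^3 - 106632*w^2*z^4 - 84888*w^2*z^5 +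
      23328*w^2*z^6 - 30564*w^2*z^7 - 97236*w^2*z^8 - 46656*w^2*z^9 - 7128*w^2*z^10 -
      24624*w^2*z^11 - 27864*w^2*z^12 - 9720*w^2*z^13 + 15292*w^3 - 112692*w^3*z - 1924*w^3*z^2 +
      61168*w^3*z^3 - 84360*w^3*z^4 - 121656*w^3*z^5 - 12744*w^3*z^6 - 22068*w^3*z^7 -
      102864*w^3*z^8 - 78516*w^3*z^9 - 22032*w^3*z^10 - 23976*w^3*z^11 - 33696*w^3*z^12 -
      17496*w^3*z^13 - 3240*w^3*z^14 + 28572*w^4 - 34716*w^4*z - 30204*w^4*z^2 + 20940*w^4*z^3 -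
      10320*w^4*z^4 - 60396*w^4*z^5 - 32076*w^4*z^6 - 3996*w^4*z^7 - 32640*w^4*z^8 - 46332*w^4*z^9
      - 20952*w^4*z^10 - 7452*w^4*z^11 - 13284*w^4*z^12 - 11664*w^4*z^13 - 3564*w^4*z^14) * hz

theorem delta_pow_six_add_one {F : Type*} [Field F] [CharZero F] {w z : F} (hw : w ^ 2 + w + 1 = 0)
    (hz : z ^ 6 + z ^ 5 + z ^ 4 + z ^ 3 + z ^ 2 + z + 1 = 0) :
    delta₁ w (z ^ 6) + 1 = (delta₁ w z + 1) * conjY w z ^ 2 := by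
  simp only [delta₁, conjY]
  linear_combination (- 48612 - 30528*z + 10032*z^2 - 26112*z^3 - 50592*z^4 - 3552*z^5 - 30528*w -
      61056*w*z - 16944*w*z^2 - 6048*w*z^3 - 55008*w*z^4 - 44112*w*z^5) * hw
    + (48612 - 17364*z - 39228*z^2 + 28956*z^3 + 18552*z^4 - 31728*z^5 - 6588*z^6 + 14496*z^7 -
      4608*z^8 - 7800*z^9 + 108*z^10 + 72*z^11 - 60*z^12 - 120*z^16 + 108*z^17 + 12*z^18 -
      120*z^23 + 120*z^24 + 78528*w + 7584*w*z - 81060*w*z^2 + 21804*w*z^3 + 47088*w*z^4 -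
      48852*w*z^5 - 25716*w*z^6 + 23472*w*z^7 - 6144*w*z^8 - 16260*w*z^9 - 36*w*z^10 + 144*w*z^11
      + 24*w*z^12 - 132*w*z^16 - 36*w*z^17 + 168*w*z^18 - 132*w*z^23 + 132*w*z^24 + 82128*w^2 +
      17520*w^2*z - 75216*w^2*z^2 + 22992*w^2*z^3 + 62544*w^2*z^4 - 29184*w^2*z^5 - 22464*w^2*z^6
      + 26304*w^2*z^7 + 5376*w^2*z^8 - 10368*w^2*z^9 + 27072*w^3 + 27072*w^3*z - 34752*w^3*z^2 -
      9600*w^3*z^3 + 26688*w^3*z^4 - 3456*w^3*z^5 - 13056*w^3*z^6 + 5568*w^3*z^7 + 3648*w^3*z^8 -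
      2112*w^3*z^9) * hz

theorem ram_cube {F : Type*} [Field F] [CharZero F] {w z : F} (hw : w ^ 2 + w + 1 = 0)
    (hz : z ^ 6 + z ^ 5 + z ^ 4 + z ^ 3 + z ^ 2 + z + 1 = 0) :
    (12 * w + 8) / 7 = delta₁ w z * ramX w z ^ 3 := by
  simp only [delta₁, ramX]
  linear_combination (- 64 + 416/7*z + 484/7*z^2 - 412/7*z^3 - 104/7*z^4 + 684/7*z^5 - 1460/7*w -
      1016/7*w*z + 260/7*w*z^2 - 788/7*w*z^3 - 1588/7*w*z^4 - 192/7*w*z^5 - 396/7*w^2 - 108*w^2*z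
      - 204/7*w^2*z^2 - 96/7*w^2*z^3 - 696/7*w^2*z^4 - 540/7*w^2*z^5) * hw
    + (92/7 - 88*z + 9484/49*z^2 - 1068/343*z^3 + 30168/343*z^4 + 145696/343*z^5 - 9532/343*z^6 +
      125304/343*z^7 + 91052/343*z^8 + 21892/343*z^9 + 2508/7*z^10 - 20400/343*z^11 +
      65700/343*z^12 - 4500/343*z^13 + 15000/343*z^14 + 1500/7*w + 1716/7*w*z + 3912/7*w*z^2 +
      140628/343*w*z^3 + 482976/343*w*z^4 + 67524/49*w*z^5 + 372156/343*w*z^6 + 644220/343*w*z^7 +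
      329724/343*w*z^8 + 503436/343*w*z^9 + 279228/343*w*z^10 + 173256/343*w*z^11 +
      176760/343*w*z^12 + 41400/343*w*z^13 + 7500/49*w*z^14 + 3228/7*w^2 + 6180/7*w^2*z +
      46272/49*w^2*z^2 + 481428/343*w^2*z^3 + 967620/343*w^2*z^4 + 900948/343*w^2*z^5 +
      1035960/343*w^2*z^6 + 964584/343*w^2*z^7 + 909672/343*w^2*z^8 + 867504/343*w^2*z^9 +
      501156/343*w^2*z^10 + 406152/343*w^2*z^11 + 235440/343*w^2*z^12 + 127980/343*w^2*z^13 +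
      68400/343*w^2*z^14 + 3508/7*w^3 + 6088/7*w^3*z + 36200/49*w^3*z^2 + 69900/49*w^3*z^3 +
      775632/343*w^3*z^4 + 843260/343*w^3*z^5 + 120712/49*w^3*z^6 + 781212/343*w^3*z^7 +
      808588/343*w^3*z^8 + 655232/343*w^3*z^9 + 443496/343*w^3*z^10 + 42792/49*w^3*z^11 +
      181404/343*w^3*z^12 + 116064/343*w^3*z^13 + 39360/343*w^3*z^14 + 1068/7*w^4 + 312*w^4*z +
      12420/49*w^4*z^2 + 136680/343*w^4*z^3 + 237756/343*w^4*z^4 + 281160/343*w^4*z^5 +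
      241620/343*w^4*z^6 + 229608/343*w^4*z^7 + 35040/49*w^4*z^8 + 28596/49*w^4*z^9 +
      127752/343*w^4*z^10 + 79428/343*w^4*z^11 + 58032/343*w^4*z^12 + 33984/343*w^4*z^13 +
      8448/343*w^4*z^14) * hz

theorem ram_sq {F : Type*} [Field F] [CharZero F] {w z : F} (hw : w ^ 2 + w + 1 = 0)
    (hz : z ^ 6 + z ^ 5 + z ^ 4 + z ^ 3 + z ^ 2 + z + 1 = 0) :
    (12 * w + 8) / 7 + 1 = (delta₁ w z + 1) * ramY w z ^ 2 := by
  simp only [delta₁, ramY]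
  linear_combination (720/7 - 396/7*z - 600/7*z^2 + 84*z^3 + 264/7*z^4 - 780/7*z^5 + 1248/7*w +
      960/7*w*z - 144/7*w*z^2 + 624/7*w*z^3 + 1392/7*w*z^4 + 288/7*w*z^5) * hw
    + (- 4884/49 + 7968/49*z + 96/7*z^2 - 10272/49*z^3 + 9648/49*z^4 - 4320/49*z^5 - 13992/49*w +
      9264/49*w*z + 10944/49*w*z^2 - 25632/49*w*z^3 + 18192/49*w*z^4 - 7632/49*w*z^5 - 1884/7*w^2
      + 8784/49*w^2*z + 10656/49*w^2*z^2 - 2976/7*w^2*z^3 + 14064/49*w^2*z^4 - 3648/49*w^2*z^5 -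
      9120/49*w^3 + 3936/49*w^3*z + 4800/49*w^3*z^2 - 6480/49*w^3*z^3 + 432/7*w^3*z^4 -
      528/49*w^3*z^5) * hz

theorem ram'_cube {F : Type*} [Field F] [CharZero F] {w z : F} (hw : w ^ 2 + w + 1 = 0)
    (hz : z ^ 6 + z ^ 5 + z ^ 4 + z ^ 3 + z ^ 2 + z + 1 = 0) :
    (-12 * w - 4) / 7 = delta₁ w z * ramX' w z ^ 3 := by
  simp only [delta₁, ramX']
  linear_combination (- 60/7 - 676/7*z - 340/7*z^2 + 16*z^3 - 396/7*z^4 - 656/7*z^5 + 1164/7*w +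
      496/7*w*z - 56*w*z^2 + 692/7*w*z^3 + 156*w*z^4 - 172/7*w*z^5 + 360/7*w^2 + 108*w^2*z +
      216/7*w^2*z^2 + 60/7*w^2*z^3 + 660/7*w^2*z^4 + 552/7*w^2*z^5) * hw
    + (2796/343 + 30388/343*z - 16740/343*z^2 - 21580/343*z^3 + 23700/343*z^4 + 10820/343*z^5 -
      25400/343*z^6 - 1800/49*z^7 + 41800/343*z^8 - 100/7*z^9 - 87000/343*z^10 + 141000/343*z^11 -
      121500/343*z^12 + 58500/343*z^13 - 15000/343*z^14 - 54312/343*w + 62100/343*w*z +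
      25044/343*w*z^2 - 68856/343*w*z^3 - 15360/343*w*z^4 + 89784/343*w*z^5 - 16980/343*w*z^6 -
      176940/343*w*z^7 + 274020/343*w*z^8 - 199560/343*w*z^9 + 13200/343*w*z^10 +
      114600/343*w*z^11 - 140400/343*w*z^12 + 80100/343*w*z^13 - 25500/343*w*z^14 - 71196/343*w^2
      + 35736/343*w^2*z + 61296/343*w^2*z^2 - 55488/343*w^2*z^3 - 89160/343*w^2*z^4 +
      30732/49*w^2*z^5 - 157560/343*w^2*z^6 - 49464/343*w^2*z^7 + 212592/343*w^2*z^8 -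
      191136/343*w^2*z^9 + 62820/343*w^2*z^10 + 34920/343*w^2*z^11 - 55080/343*w^2*z^12 +
      4860/49*w^2*z^13 - 11700/343*w^2*z^14 - 75864/343*w^3 + 5444/343*w^3*z + 103956/343*w^3*z^2
      - 88076/343*w^3*z^3 - 6084/49*w^3*z^4 + 127060/343*w^3*z^5 - 90376/343*w^3*z^6 +
      1044/343*w^3*z^7 + 53492/343*w^3*z^8 - 52664/343*w^3*z^9 + 20760/343*w^3*z^10 +
      4728/343*w^3*z^11 - 1296/49*w^3*z^12 + 5868/343*w^3*z^13 - 300/49*w^3*z^14 - 20232/343*w^4 -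
      11628/343*w^4*z + 26568/343*w^4*z^2 - 15912/343*w^4*z^3 - 5112/343*w^4*z^4 +
      17508/343*w^4*z^5 - 11868/343*w^4*z^6 + 792/343*w^4*z^7 + 4320/343*w^4*z^8 -
      4476/343*w^4*z^9 + 1884/343*w^4*z^10 + 240/343*w^4*z^11 - 540/343*w^4*z^12 +
      360/343*w^4*z^13 - 132/343*w^4*z^14) * hz

theorem ram'_sq {F : Type*} [Field F] [CharZero F] {w z : F} (hw : w ^ 2 + w + 1 = 0)
    (hz : z ^ 6 + z ^ 5 + z ^ 4 + z ^ 3 + z ^ 2 + z + 1 = 0) :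
    (-12 * w - 4) / 7 + 1 = (delta₁ w z + 1) * ramY' w z ^ 2 := by
  simp only [delta₁, ramY']
  linear_combination (828/7 + 1356/7*z + 288/7*z^2 + 228/7*z^3 + 1320/7*z^4 + 900/7*z^5 - 288/7*w
      + 960/7*w*z + 96*w*z^2 - 432/7*w*z^3 + 48*w*z^4 + 1104/7*w*z^5) * hw
    + (- 4500/49 - 6372/49*z + 6060/49*z^2 + 2160/49*z^3 - 960/7*z^4 - 4320/49*z^5 + 1968/49*z^6 +
      96/49*z^7 - 576/7*z^8 - 1920/49*z^9 - 312/7*w - 23736/49*w*z + 1920/49*w*z^2 + 192*w*z^3 -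
      23424/49*w*z^4 - 24816/49*w*z^5 - 8496/49*w*z^6 + 48*w*z^7 - 17664/49*w*z^8 - 13632/49*w*z^9
      - 8196/49*w^2 - 33456/49*w^2*z - 6528/49*w^2*z^2 - 1872/49*w^2*z^3 - 44448/49*w^2*z^4 -
      6144/7*w^2*z^5 - 27168/49*w^2*z^6 - 9984/49*w^2*z^7 - 22656/49*w^2*z^8 - 29952/49*w^2*z^9 -
      4128/49*w^3 - 24096/49*w^3*z - 1632/7*w^3*z^2 - 6096/49*w^3*z^3 - 26352/49*w^3*z^4 -
      36432/49*w^3*z^5 - 22464/49*w^3*z^6 - 3840/49*w^3*z^7 - 17856/49*w^3*z^8 - 19008/49*w^3*z^9)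
      * hz

/-- The factors are a square root of `-3` and the quadratic Gauss sum, a square root of `-7`. -/
theorem sqrt_twentyone {F : Type*} [Field F] [CharZero F] {w z : F} (hw : w ^ 2 + w + 1 = 0)
    (hz : z ^ 6 + z ^ 5 + z ^ 4 + z ^ 3 + z ^ 2 + z + 1 = 0) :
    ((2 * w + 1) * (2 * (z + z ^ 2 + z ^ 4) + 1)) ^ 2 = 21 := by
  linear_combination (- 28) * hw
    + (8 - 4*z + 4*z^2 + 32*w - 16*w*z + 16*w*z^2 + 32*w^2 - 16*w^2*z + 16*w^2*z^2) * hz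

/-- The squares modulo 7 are 1, 2, 4, so this and the next two symmetric functions lie in `ℚ(√21)`;
they are the coefficients of a cubic factor of the sextic. -/
theorem delta_sum {F : Type*} [Field F] [CharZero F] {w z : F} (hw : w ^ 2 + w + 1 = 0)
    (hz : z ^ 6 + z ^ 5 + z ^ 4 + z ^ 3 + z ^ 2 + z + 1 = 0) :
    delta₁ w z + delta₁ w (z ^ 2) + delta₁ w (z ^ 4)
      = -282 + 66 * ((2 * w + 1) * (2 * (z + z ^ 2 + z ^ 4) + 1)) := by
  simp only [delta₁]
  linear_combination (0) * hw
    + (60 - 96*z + 84*z^2 - 108*z^3 + 120*z^4 + 60*z^5 - 180*z^6 + 120*z^7 - 12*z^9 + 12*z^10 -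
      120*z^13 + 120*z^14 + 156*w - 228*w*z + 60*w*z^2 + 36*w*z^3 + 132*w*z^4 - 24*w*z^5 -
      108*w*z^6 + 132*w*z^7 - 168*w*z^9 + 168*w*z^10 - 132*w*z^13 + 132*w*z^14) * hz

theorem delta_sum_mul {F : Type*} [Field F] [CharZero F] {w z : F} (hw : w ^ 2 + w + 1 = 0)
    (hz : z ^ 6 + z ^ 5 + z ^ 4 + z ^ 3 + z ^ 2 + z + 1 = 0) :
    delta₁ w z * delta₁ w (z ^ 2) + delta₁ w z * delta₁ w (z ^ 4)
        + delta₁ w (z ^ 2) * delta₁ w (z ^ 4)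
      = 3072 - 672 * ((2 * w + 1) * (2 * (z + z ^ 2 + z ^ 4) + 1)) := by
  simp only [delta₁]
  linear_combination (- 6048) * hw
    + (11760 - 20400*z - 8736*z^2 + 32832*z^3 - 26016*z^4 + 9600*z^5 + 32688*z^6 - 25008*z^7 -
      20160*z^8 + 30480*z^9 - 4416*z^10 - 24624*z^11 + 36720*z^12 + 5568*z^13 - 26448*z^14 +
      720*z^15 + 6480*z^16 - 4464*z^17 - 2736*z^18 + 20160*z^19 - 5760*z^20 - 1440*z^21 +
      1440*z^22 - 14400*z^23 + 14400*z^24 - 22560*w + 23712*w*z + 9888*w*z^2 + 11808*w*z^3 -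
      5088*w*z^4 + 41088*w*z^5 + 14400*w*z^6 - 80112*w*z^7 + 56304*w*z^8 + 53040*w*z^9 -
      42528*w*z^10 - 22896*w*z^11 + 73440*w*z^12 - 11472*w*z^13 - 60816*w*z^14 + 40032*w*z^15 +
      12528*w*z^16 - 17424*w*z^17 + 12384*w*z^18 + 14976*w*z^19 + 16704*w*z^20 - 21744*w*z^21 +
      21744*w*z^22 - 31680*w*z^23 + 31680*w*z^24 + 33696*w^2 + 3168*w^2*z + 11520*w^2*z^2 -
      6912*w^2*z^3 + 50688*w^2*z^4 - 13824*w^2*z^5 + 10512*w^2*z^6 - 19152*w^2*z^7 + 66240*w^2*z^8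
      - 9936*w^2*z^9 - 25344*w^2*z^10 + 25488*w^2*z^11 + 38880*w^2*z^12 - 38304*w^2*z^13 -
      2016*w^2*z^14 + 29232*w^2*z^15 + 19872*w^2*z^16 - 37728*w^2*z^17 + 40896*w^2*z^18 -
      7920*w^2*z^19 + 25344*w^2*z^20 - 22176*w^2*z^21 + 22176*w^2*z^22 - 17424*w^2*z^23 +
      17424*w^2*z^24) * hz

theorem delta_prod {F : Type*} [Field F] [CharZero F] {w z : F} (hw : w ^ 2 + w + 1 = 0)
    (hz : z ^ 6 + z ^ 5 + z ^ 4 + z ^ 3 + z ^ 2 + z + 1 = 0) :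
    delta₁ w z * delta₁ w (z ^ 2) * delta₁ w (z ^ 4)
      = -3520 + 768 * ((2 * w + 1) * (2 * (z + z ^ 2 + z ^ 4) + 1)) := by
  simp only [delta₁]
  linear_combination (5184 - 1728*z - 1728*z^2 - 1728*z^4 - 1728*w - 3456*w*z - 3456*w*z^2 -
      3456*w*z^4) * hw
    + (- 143040 + 402816*z + 227136*z^2 - 1128384*z^3 + 741504*z^4 - 374592*z^5 - 1213056*z^6 +
      2491392*z^7 + 20160*z^8 - 2105472*z^9 + 1050816*z^10 + 1048896*z^11 - 2175552*z^12 +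
      1362048*z^13 + 1665984*z^14 - 1929600*z^15 - 584064*z^16 + 1481472*z^17 - 974016*z^18 +
      767808*z^19 + 1071936*z^20 - 1853568*z^21 - 418752*z^22 + 2407680*z^23 - 1301760*z^24 -
      622080*z^25 + 1918080*z^26 - 864000*z^27 - 1555200*z^28 + 1728000*z^29 + 773760*w -
      1210944*w*z - 676416*w*z^2 + 745344*w*z^3 - 774912*w*z^4 - 1167936*w*z^5 + 884160*w*z^6 +
      6209088*w*z^7 - 4199616*w*z^8 - 1488192*w*z^9 + 3490368*w*z^10 + 1309824*w*z^11 -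
      4269888*w*z^12 + 4768896*w*z^13 + 1195008*w*z^14 - 1934784*w*z^15 - 1003968*w*z^16 +
      2183040*w*z^17 - 657792*w*z^18 + 4178880*w*z^19 - 2017728*w*z^20 - 2568960*w*z^21 +
      2501568*w*z^22 + 4370688*w*z^23 - 4899456*w*z^24 + 1752192*w*z^25 + 2783808*w*z^26 -
      1555200*w*z^27 - 2903040*w*z^28 + 5702400*w*z^29 - 1441152*w^2 + 414144*w^2*z +
      175104*w^2*z^2 + 1681344*w^2*z^3 - 1745856*w^2*z^4 + 2704320*w^2*z^5 + 1416384*w^2*z^6 +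
      5606208*w^2*z^7 - 3653568*w^2*z^8 + 2714688*w^2*z^9 + 2570688*w^2*z^10 + 1831680*w^2*z^11 -
      3312576*w^2*z^12 + 7272576*w^2*z^13 + 1088064*w^2*z^14 - 398592*w^2*z^15 - 1743552*w^2*z^16
      + 5136192*w^2*z^17 + 311616*w^2*z^18 + 4275648*w^2*z^19 - 2394432*w^2*z^20 +
      1678464*w^2*z^21 + 2054016*w^2*z^22 + 4054464*w^2*z^23 - 3779712*w^2*z^24 + 4909248*w^2*z^25
      + 2037312*w^2*z^26 - 285120*w^2*z^27 - 741312*w^2*z^28 + 6272640*w^2*z^29 + 886464*w^3 +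
      886464*w^3*z + 552960*w^3*z^2 + 1434240*w^3*z^3 + 1219968*w^3*z^4 + 1323648*w^3*z^5 +
      2004480*w^3*z^6 + 3112128*w^3*z^7 - 25920*w^3*z^8 + 1479168*w^3*z^9 + 2236032*w^3*z^10 +
      1372032*w^3*z^11 + 825984*w^3*z^12 + 3428352*w^3*z^13 + 825984*w^3*z^14 + 577152*w^3*z^15 +
      1683072*w^3*z^16 + 2386368*w^3*z^17 + 1118016*w^3*z^18 + 2612736*w^3*z^19 + 457920*w^3*z^20
      + 934848*w^3*z^21 + 2384640*w^3*z^22 + 2376000*w^3*z^23 + 38016*w^3*z^24 + 2452032*w^3*z^25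
      + 1425600*w^3*z^26 + 418176*w^3*z^27 + 627264*w^3*z^28 + 2299968*w^3*z^29) * hz

/-- The six conjugates of `dblX` over `ℚ(ζ₃)` form a basis of `ℚ(ζ₃, ζ₇)`; these are the coordinates
of `z`, with denominator 27. It serves to recover `ζ₇` from torsion coordinates. -/
theorem zeta_eq_sum_dblX {F : Type*} [Field F] [CharZero F] {w z : F} (hw : w ^ 2 + w + 1 = 0)
    (hz : z ^ 6 + z ^ 5 + z ^ 4 + z ^ 3 + z ^ 2 + z + 1 = 0) :
    27 * z = (-4 + (-2) * w) * dblX w z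
      + (-1 + (4) * w) * dblX w (z ^ 2)
      + (1 + (-1) * w) * dblX w (z ^ 3)
      + (2 + (1) * w) * dblX w (z ^ 4)
      + (-5 + (-4) * w) * dblX w (z ^ 5)
      + (-2 + (2) * w) * dblX w (z ^ 6) := by
  simp only [dblX]
  linear_combination (18 + 36*z + 18*z^2 + 18*z^3 + 18*z^4 + 18*z^5) * hw
    + (- 9 - 5*z^2 - 7*z^4 + 11*z^5 + 10*z^6 - 9*z^7 - 3*z^8 - 3*z^9 + 8*z^10 - 14*z^11 + 12*z^12
      + 9*z^13 - 9*z^14 - 4*z^16 + 6*z^17 - 12*z^18 + 10*z^19 - 4*z^23 + 4*z^24 - 18*w - 18*w*z +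
      16*w*z^2 + 12*w*z^3 - 25*w*z^4 + 23*w*z^5 + 10*w*z^6 - 18*w*z^7 - 15*w*z^8 + 12*w*z^9 +
      5*w*z^10 - 17*w*z^11 + 15*w*z^12 + 18*w*z^13 - 18*w*z^14 + 2*w*z^16 - 15*w*z^18 + 13*w*z^19
      + 2*w*z^23 - 2*w*z^24 - 18*w^2 - 18*w^2*z + 16*w^2*z^2 + 6*w^2*z^3 - 4*w^2*z^4 + 2*w^2*z^5 +
      7*w^2*z^6 - 9*w^2*z^7 - 9*w^2*z^8 + 9*w^2*z^9 - 4*w^2*z^10 + 4*w^2*z^11 + 9*w^2*z^13 -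
      9*w^2*z^14 + 2*w^2*z^16 - 6*w^2*z^17 + 4*w^2*z^19 + 2*w^2*z^23 - 2*w^2*z^24) * hz

/-! ### The conjugates of `δ₁` and the roots of the torsion polynomial. -/

theorem phi_seven_pow_four {F : Type*} [Field F] {z : F}
    (hz : z ^ 6 + z ^ 5 + z ^ 4 + z ^ 3 + z ^ 2 + z + 1 = 0) :
    (z ^ 4) ^ 6 + (z ^ 4) ^ 5 + (z ^ 4) ^ 4 + (z ^ 4) ^ 3 + (z ^ 4) ^ 2 + z ^ 4 + 1 = 0 := by
  have h7 : z ^ 7 = 1 := by linear_combination (z - 1) * hz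
  linear_combination hz + (z ^ 17 + z ^ 10 + z ^ 13 + z ^ 3 + z ^ 6 + z ^ 9 + z ^ 2 + z + z ^ 5) * h7

theorem phi_seven_pow_six {F : Type*} [Field F] {z : F}
    (hz : z ^ 6 + z ^ 5 + z ^ 4 + z ^ 3 + z ^ 2 + z + 1 = 0) :
    (z ^ 6) ^ 6 + (z ^ 6) ^ 5 + (z ^ 6) ^ 4 + (z ^ 6) ^ 3 + (z ^ 6) ^ 2 + z ^ 6 + 1 = 0 := by
  have h7 : z ^ 7 = 1 := by linear_combination (z - 1) * hz
  linear_combination hz + (z ^ 29 + z ^ 22 + z ^ 15 + z ^ 8 + z + z ^ 23 + z ^ 16 + z ^ 9 + z ^ 2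
    + z ^ 17 + z ^ 10 + z ^ 3 + z ^ 11 + z ^ 4 + z ^ 5) * h7

/-- The product of the three factors `T - δ₁(ζ₃, ζ₇ ^ k)` with `k` a square modulo `7`. -/
theorem prod_sub_delta {F : Type*} [Field F] [CharZero F] {w z : F} (hw : w ^ 2 + w + 1 = 0)
    (hz : z ^ 6 + z ^ 5 + z ^ 4 + z ^ 3 + z ^ 2 + z + 1 = 0) (T : F) :
    (T - delta₁ w z) * (T - delta₁ w (z ^ 2)) * (T - delta₁ w (z ^ 4))
      = T ^ 3 + 282 * T ^ 2 + 3072 * T + 3520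
        - (2 * w + 1) * (2 * (z + z ^ 2 + z ^ 4) + 1) * (66 * T ^ 2 + 672 * T + 768) := by
  linear_combination -T ^ 2 * delta_sum hw hz + T * delta_sum_mul hw hz - delta_prod hw hz

/-- The sextic polynomial whose roots are the conjugates of `δ₁`. -/
theorem prod_six_sub_delta {F : Type*} [Field F] [CharZero F] {w z : F}
    (hw : w ^ 2 + w + 1 = 0)
    (hz : z ^ 6 + z ^ 5 + z ^ 4 + z ^ 3 + z ^ 2 + z + 1 = 0) (T : F) :
    (T - delta₁ w z) * (T - delta₁ w (z ^ 2)) * (T - delta₁ w (z ^ 4))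
      * ((T - delta₁ w (z ^ 6)) * (T - delta₁ w (z ^ 5)) * (T - delta₁ w (z ^ 3)))
      = T ^ 6 + 564 * T ^ 5 - 5808 * T ^ 4 - 123136 * T ^ 3 - 189696 * T ^ 2 - 49152 * T
        + 4096 := by
  have h7 : z ^ 7 = 1 := by linear_combination (z - 1) * hz
  have h5 : (z ^ 6) ^ 2 = z ^ 5 := by linear_combination z ^ 5 * h7
  have h3 : (z ^ 6) ^ 4 = z ^ 3 := by linear_combination (z ^ 17 + z ^ 10 + z ^ 3) * h7
  have h1 := prod_sub_delta hw hz T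
  have h2 := prod_sub_delta hw (phi_seven_pow_six hz) T
  rw [h5, h3] at h2
  -- Replacing residues by non-residues changes the sign of the Gauss sum, so the two cubics are
  -- conjugate over `ℚ` and their product is rational.
  have hconj : (2 * w + 1) * (2 * (z ^ 6 + z ^ 5 + z ^ 3) + 1)
      = -((2 * w + 1) * (2 * (z + z ^ 2 + z ^ 4) + 1)) := by
    linear_combination 2 * (2 * w + 1) * hz
  rw [h1, h2, hconj]
  linear_combination -(66 * T ^ 2 + 672 * T + 768) ^ 2 * sqrt_twentyone hw hz

/-- `T` is `δ₁` times a cube and `T + 1` is `δ₁ + 1` times a square, in the subfield `S`. -/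
def DeltaEquiv {F : Type*} [Field F] (S : Subfield F) (w z T : F) : Prop :=
  ∃ a ∈ S, ∃ b ∈ S, T = delta₁ w z * a ^ 3 ∧ T + 1 = (delta₁ w z + 1) * b ^ 2

theorem dblX_mem {F : Type*} [Field F] {S : Subfield F} {w z : F} (hw : w ∈ S) (hz : z ∈ S) :
    dblX w z ∈ S := by
  lift w to S using hw
  lift z to S using hz
  exact SetLike.coe_mem (dblX w z)

theorem dblY_mem {F : Type*} [Field F] {S : Subfield F} {w z : F} (hw : w ∈ S) (hz : z ∈ S) :
    dblY w z ∈ S := by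
  lift w to S using hw
  lift z to S using hz
  exact SetLike.coe_mem (dblY w z)

theorem DeltaEquiv.pow_four {F : Type*} [Field F] [CharZero F] {S : Subfield F} {w z : F}
    (hw : w ^ 2 + w + 1 = 0) (hwS : w ∈ S) {ξ : F} (hξS : ξ ∈ S)
    (hξ : ξ ^ 6 + ξ ^ 5 + ξ ^ 4 + ξ ^ 3 + ξ ^ 2 + ξ + 1 = 0)
    (h : DeltaEquiv S w z (delta₁ w ξ)) : DeltaEquiv S w z (delta₁ w (ξ ^ 4)) := by
  obtain ⟨a, ha, b, hb, h1, h2⟩ := h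
  refine ⟨a * dblX w ξ, mul_mem ha (dblX_mem hwS hξS), b * dblY w ξ,
    mul_mem hb (dblY_mem hwS hξS), ?_, ?_⟩
  · rw [delta_pow_four hw hξ, h1]; ring
  · rw [delta_pow_four_add_one hw hξ, h2]; ring

theorem conjX_mem {F : Type*} [Field F] {S : Subfield F} {w z : F} (hw : w ∈ S) (hz : z ∈ S) :
    conjX w z ∈ S := by
  lift w to S using hw
  lift z to S using hz
  exact SetLike.coe_mem (conjX w z)

theorem conjY_mem {F : Type*} [Field F] {S : Subfield F} {w z : F} (hw : w ∈ S) (hz : z ∈ S) :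
    conjY w z ∈ S := by
  lift w to S using hw
  lift z to S using hz
  exact SetLike.coe_mem (conjY w z)

theorem deltaEquiv_ram {F : Type*} [Field F] [CharZero F] {S : Subfield F} {w z : F}
    (hw : w ^ 2 + w + 1 = 0) (hz : z ^ 6 + z ^ 5 + z ^ 4 + z ^ 3 + z ^ 2 + z + 1 = 0)
    (hwS : w ∈ S) (hzS : z ∈ S) : DeltaEquiv S w z ((12 * w + 8) / 7) := by
  refine ⟨ramX w z, ?_, ramY w z, ?_, ram_cube hw hz, ram_sq hw hz⟩
  · lift w to S using hwS
    lift z to S using hzS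
    exact SetLike.coe_mem (ramX w z)
  · lift w to S using hwS
    lift z to S using hzS
    exact SetLike.coe_mem (ramY w z)

theorem deltaEquiv_ram' {F : Type*} [Field F] [CharZero F] {S : Subfield F} {w z : F}
    (hw : w ^ 2 + w + 1 = 0) (hz : z ^ 6 + z ^ 5 + z ^ 4 + z ^ 3 + z ^ 2 + z + 1 = 0)
    (hwS : w ∈ S) (hzS : z ∈ S) : DeltaEquiv S w z ((-12 * w - 4) / 7) := by
  refine ⟨ramX' w z, ?_, ramY' w z, ?_, ram'_cube hw hz, ram'_sq hw hz⟩
  · lift w to S using hwS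
    lift z to S using hzS
    exact SetLike.coe_mem (ramX' w z)
  · lift w to S using hwS
    lift z to S using hzS
    exact SetLike.coe_mem (ramY' w z)

/-- The roots of the polynomial for `x³ / c` on the points of order `7`. -/
theorem deltaEquiv_of_root {F : Type*} [Field F] [CharZero F] {S : Subfield F} {w z : F}
    (hw : w ^ 2 + w + 1 = 0) (hz : z ^ 6 + z ^ 5 + z ^ 4 + z ^ 3 + z ^ 2 + z + 1 = 0)
    (hwS : w ∈ S) (hzS : z ∈ S) {T : F}
    (hT : (7 * T ^ 2 - 4 * T + 16) * (T ^ 6 + 564 * T ^ 5 - 5808 * T ^ 4 - 123136 * T ^ 3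
      - 189696 * T ^ 2 - 49152 * T + 4096) = 0) : DeltaEquiv S w z T := by
  have h7 : z ^ 7 = 1 := by linear_combination (z - 1) * hz
  -- Multiplication by 4 on exponents modulo 7 has the orbits `1, 4, 2` and `6, 3, 5`; the
  -- identities for `conjX` and `conjY` pass from the first to the second.
  have d1 : DeltaEquiv S w z (delta₁ w z) :=
    ⟨1, one_mem S, 1, one_mem S, by ring, by ring⟩
  have d4 := d1.pow_four hw hwS hzS hz
  have d2 := d4.pow_four hw hwS (pow_mem hzS 4) (phi_seven_pow_four hz)
  have d6 : DeltaEquiv S w z (delta₁ w (z ^ 6)) :=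
    ⟨conjX w z, conjX_mem hwS hzS, conjY w z, conjY_mem hwS hzS, delta_pow_six hw hz,
      delta_pow_six_add_one hw hz⟩
  have d3 := d6.pow_four hw hwS (pow_mem hzS 6) (phi_seven_pow_six hz)
  have d5 := d3.pow_four hw hwS (pow_mem (pow_mem hzS 6) 4)
    (phi_seven_pow_four (phi_seven_pow_six hz))
  have e2 : (z ^ 4) ^ 4 = z ^ 2 := by linear_combination (z ^ 9 + z ^ 2) * h7
  have e3 : (z ^ 6) ^ 4 = z ^ 3 := by linear_combination (z ^ 17 + z ^ 10 + z ^ 3) * h7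
  have e5 : (z ^ 3) ^ 4 = z ^ 5 := by linear_combination z ^ 5 * h7
  rw [e2] at d2
  rw [e3] at d3
  rw [e3, e5] at d5
  rw [← prod_six_sub_delta hw hz] at hT
  rcases mul_eq_zero.mp hT with h | h
  -- The quadratic factor splits over `ℚ(ζ₃)`, with root sum `4/7` and root product `16/7`.
  · have h' : (T - (12 * w + 8) / 7) * (T - (-12 * w - 4) / 7) = 0 := by
      linear_combination h / 7 - (144 / 49) * hw
    rcases mul_eq_zero.mp h' with h' | h'
    · rw [sub_eq_zero.mp h']
      exact deltaEquiv_ram hw hz hwS hzS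
    · rw [sub_eq_zero.mp h']
      exact deltaEquiv_ram' hw hz hwS hzS
  · rcases mul_eq_zero.mp h with h | h <;> rcases mul_eq_zero.mp h with h | h <;>
      first | (rcases mul_eq_zero.mp h with h | h <;> rw [sub_eq_zero.mp h] <;> assumption)
            | (rw [sub_eq_zero.mp h]; assumption)

/-- At `δ₁ = -1` the identity for `δ₁ - 8` would read `-9 = 0`. -/
theorem delta_add_one_ne_zero {F : Type*} [Field F] [CharZero F] {w z : F}
    (hw : w ^ 2 + w + 1 = 0) (hz : z ^ 6 + z ^ 5 + z ^ 4 + z ^ 3 + z ^ 2 + z + 1 = 0) :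
    delta₁ w z + 1 ≠ 0 := by
  intro h
  have h1 := delta_sub_eight hw hz
  have : (9 : F) = 0 := by linear_combination (1 - 4 * dblX w z) * h - h1
  norm_num at this

/-- A zero at `z` would propagate to `z ^ 4` and `z ^ 2`, and each of the three ratios would be `-8
/ 4 = -2`; but their product is 1, not `-8`. -/
theorem delta_ne_zero {F : Type*} [Field F] [CharZero F] {w z : F}
    (hw : w ^ 2 + w + 1 = 0) (hz : z ^ 6 + z ^ 5 + z ^ 4 + z ^ 3 + z ^ 2 + z + 1 = 0) :
    delta₁ w z ≠ 0 := by
  intro h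
  have h7 : z ^ 7 = 1 := by linear_combination (z - 1) * hz
  have e2 : (z ^ 4) ^ 4 = z ^ 2 := by linear_combination (z ^ 9 + z ^ 2) * h7
  have hz4 := phi_seven_pow_four hz
  have key : ∀ {ξ : F}, ξ ^ 6 + ξ ^ 5 + ξ ^ 4 + ξ ^ 3 + ξ ^ 2 + ξ + 1 = 0 → delta₁ w ξ = 0 →
      dblX w ξ = -2 ∧ delta₁ w (ξ ^ 4) = 0 := by
    intro ξ hξ h0
    have h1 := delta_sub_eight hw hξ
    rw [delta_pow_four hw hξ, h0]
    refine ⟨?_, by ring⟩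
    rw [h0] at h1
    linear_combination -h1 / 4
  obtain ⟨u1, h4⟩ := key hz h
  obtain ⟨u4, h2⟩ := key hz4 h4
  obtain ⟨u2, -⟩ := key (phi_seven_pow_four hz4) h2
  rw [e2] at u2
  have := dblX_mul hw hz
  rw [u1, u4, u2] at this
  norm_num at this

/-! ### Doubling and the points of order 7 on `y² = x³ + c`. -/

open WeierstrassCurve.Affine in
theorem mordell_equation_iff {F : Type*} [Field F] {c x y : F} :
    (mordellCurve c).toAffine.Equation x y ↔ y ^ 2 = x ^ 3 + c := by
  rw [equation_iff]
  simp [mordellCurve]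

open WeierstrassCurve.Affine in
theorem mordell_negY {F : Type*} [Field F] (c x y : F) :
    (mordellCurve c).toAffine.negY x y = -y := by
  simp [negY, mordellCurve]

open WeierstrassCurve.Affine in
theorem mordell_nonsingular {F : Type*} [Field F] [CharZero F] {c : F} (hc : c ≠ 0) {x y : F}
    (h : y ^ 2 = x ^ 3 + c) : (mordellCurve c).toAffine.Nonsingular x y := by
  rw [nonsingular_iff, mordell_equation_iff]
  refine ⟨h, ?_⟩
  by_contra! hcon
  simp only [mordellCurve, zero_mul, mul_zero, add_zero, sub_zero] at hcon
  have hy : y = 0 := by linear_combination hcon.2 / 2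
  have hx : x = 0 := by
    have : 3 * x ^ 2 = 0 := by linear_combination -hcon.1
    simpa using this
  apply hc
  rw [hx, hy] at h
  linear_combination -h

open WeierstrassCurve.Affine in
/-- Doubling on `y² = x³ + c`. -/
theorem mordell_add_self {F : Type*} [Field F] [CharZero F] [DecidableEq F] {c x y : F}
    (h : (mordellCurve c).toAffine.Nonsingular x y) (hy : y ≠ 0) {x₂ y₂ : F}
    (hx₂ : x₂ * (4 * y ^ 2) = x * (x ^ 3 - 8 * c))
    (hy₂ : y₂ * (8 * y ^ 3) = x ^ 6 + 20 * c * x ^ 3 - 8 * c ^ 2) :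
    ∃ h₂ : (mordellCurve c).toAffine.Nonsingular x₂ y₂,
      Point.some x y h + Point.some x y h = Point.some x₂ y₂ h₂ := by
  have he := mordell_equation_iff.mp h.1
  have hne : y ≠ (mordellCurve c).toAffine.negY x y := by
    rw [mordell_negY]
    intro h'
    exact hy (by linear_combination h' / 2)
  have hs : (mordellCurve c).toAffine.slope x x y y = 3 * x ^ 2 / (2 * y) := by
    rw [slope_of_Y_ne rfl hne, mordell_negY]
    simp only [mordellCurve]
    ring
  have ex : x₂ = x * (x ^ 3 - 8 * c) / (4 * y ^ 2) := eq_div_of_mul_eq (by simp [hy]) hx₂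
  have ey : y₂ = (x ^ 6 + 20 * c * x ^ 3 - 8 * c ^ 2) / (8 * y ^ 3) :=
    eq_div_of_mul_eq (by simp [hy]) hy₂
  have hX : (mordellCurve c).toAffine.addX x x ((mordellCurve c).toAffine.slope x x y y) = x₂ := by
    rw [hs, ex]
    simp only [addX, mordellCurve]
    field_simp
    linear_combination (-32 * x) * he
  have hY : (mordellCurve c).toAffine.addY x x y ((mordellCurve c).toAffine.slope x x y y)
      = y₂ := by
    rw [addY, negAddY, hX, mordell_negY, hs, ex, ey]
    field_simp
    have h4 : y ^ 4 = (x ^ 3 + c) ^ 2 := by rw [← he]; ring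
    linear_combination 96 * x ^ 3 * he - 64 * h4
  rw [Point.add_self_of_Y_ne hne]
  subst hX hY
  exact ⟨_, rfl⟩

/-- The condition that `P`, `2P` and `4P` are collinear, as an equation for `x(P)³`. -/
theorem seven_torsion_equation {F : Type*} [Field F] [CharZero F] {c x y x₂ y₂ x₄ : F}
    (he : y ^ 2 = x ^ 3 + c)
    (hx₂ : x₂ * (4 * y ^ 2) = x * (x ^ 3 - 8 * c))
    (hy₂ : y₂ * (8 * y ^ 3) = x ^ 6 + 20 * c * x ^ 3 - 8 * c ^ 2)
    (hx₄ : x₄ * (4 * y₂ ^ 2) = x₂ * (x₂ ^ 3 - 8 * c))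
    (h : (y - y₂) ^ 2 = (x₄ + x + x₂) * (x - x₂) ^ 2) :
    (7 * x ^ 6 - 4 * c * x ^ 3 + 16 * c ^ 2)
      * (x ^ 18 + 564 * c * x ^ 15 - 5808 * c ^ 2 * x ^ 12 - 123136 * c ^ 3 * x ^ 9
        - 189696 * c ^ 4 * x ^ 6 - 49152 * c ^ 5 * x ^ 3 + 4096 * c ^ 6) = 0 := by
  set X := x ^ 3 with hX
  have hc : y ^ 2 = X + c := he
  set N := X ^ 2 + 20 * c * X - 8 * c ^ 2 with hN
  have hy₂' : y₂ * (8 * y ^ 3) = N := by rw [hy₂, hN, hX]; ring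
  -- This is the source of the quadratic factor. When it vanishes and `y ≠ 0`, the points `P` and
  -- `2P` have the same `y`-coordinate, so `2P` is the image of `P` under an automorphism `ζ₃ ^ k`,
  -- and `P` is killed by an element `2 - ζ₃ ^ k` of norm 7.
  have e1 : (y - y₂) * (8 * y ^ 3) = 7 * X ^ 2 - 4 * c * X + 16 * c ^ 2 := by
    linear_combination -hy₂' + 8 * (y ^ 2 + X + c) * hc
  have e2 : (x - x₂) * (4 * y ^ 2) = 3 * x * (X + 4 * c) := by
    linear_combination 4 * x * hc - hx₂
  have e4 : x₄ * (16 * y ^ 2 * N ^ 2)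
      = x * (X - 8 * c) * (X * (X - 8 * c) ^ 3 - 512 * c * (X + c) ^ 3) := by
    rw [← hc, ← hy₂']
    have : x₂ ^ 3 * (4 * y ^ 2) ^ 3 = X * (X - 8 * c) ^ 3 := by
      rw [← mul_pow, hx₂, hX]; ring
    linear_combination 256 * y ^ 8 * hx₄ + x₂ * (4 * y ^ 2) * this
      + (X * (X - 8 * c) ^ 3 - 512 * c * y ^ 6) * hx₂
  have e5 : (x₄ + x + x₂) * (16 * y ^ 2 * N ^ 2)
      = x * ((X - 8 * c) * (X * (X - 8 * c) ^ 3 - 512 * c * (X + c) ^ 3)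
        + 16 * (X + c) * N ^ 2 + 4 * (X - 8 * c) * N ^ 2) := by
    linear_combination e4 + 16 * x * N ^ 2 * hc + 4 * N ^ 2 * hx₂
  have e6 : 4 * N ^ 2 * (7 * X ^ 2 - 4 * c * X + 16 * c ^ 2) ^ 2
      = 9 * X * (X + 4 * c) ^ 2 * ((X - 8 * c) * (X * (X - 8 * c) ^ 3 - 512 * c * (X + c) ^ 3)
        + 16 * (X + c) * N ^ 2 + 4 * (X - 8 * c) * N ^ 2) := by
    calc _ = 4 * N ^ 2 * ((y - y₂) ^ 2 * (8 * y ^ 3) ^ 2) := by rw [← e1]; ring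
      _ = ((x₄ + x + x₂) * (16 * y ^ 2 * N ^ 2)) * ((x - x₂) * (4 * y ^ 2)) ^ 2 := by rw [h]; ring
      _ = _ := by rw [e5, e2, hX]; ring
  rw [hN] at e6
  rw [hX] at e6
  linear_combination e6

open WeierstrassCurve.Affine in
theorem torsion_root {F : Type*} [Field F] [CharZero F] [DecidableEq F] {c : F} (hc : c ≠ 0)
    {x y : F} (h : (mordellCurve c).toAffine.Nonsingular x y)
    (h7 : 7 • Point.some x y h = 0) :
    (7 * (x ^ 3 / c) ^ 2 - 4 * (x ^ 3 / c) + 16) * ((x ^ 3 / c) ^ 6 + 564 * (x ^ 3 / c) ^ 5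
      - 5808 * (x ^ 3 / c) ^ 4 - 123136 * (x ^ 3 / c) ^ 3
      - 189696 * (x ^ 3 / c) ^ 2 - 49152 * (x ^ 3 / c) + 4096) = 0 := by
  have he := mordell_equation_iff.mp h.1
  set P := Point.some x y h with hP
  have hP0 : P ≠ 0 := Point.some_ne_zero h
  -- By Bézout, a multiple `n` prime to 7 that kills `P` would force `P = 0`. This excludes `2P =
  -- 0`, `4P = 0` and `2P = ±P`, the degenerate cases of the addition formulas.
  have hmul : ∀ n : ℤ, n • P = 0 → (7 : ℤ) ∣ n := by
    intro n hn
    by_contra hcon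
    have hcop : IsCoprime (7 : ℤ) n :=
      (Int.prime_iff_natAbs_prime.mpr (by norm_num)).coprime_iff_not_dvd.mpr hcon
    obtain ⟨a, b, hab⟩ := hcop
    apply hP0
    calc P = (a * 7 + b * n) • P := by rw [hab, one_smul]
      _ = a • ((7 : ℕ) • P) + b • (n • P) := by
        rw [add_smul, mul_smul, mul_smul, ← natCast_zsmul]; rfl
      _ = 0 := by rw [h7, hn, smul_zero, smul_zero, add_zero]
  have hy : y ≠ 0 := by
    rintro rfl
    have : P + P = 0 := Point.add_self_of_Y_eq (by rw [mordell_negY]; simp)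
    have := hmul 2 (by rw [two_smul, this])
    omega
  obtain ⟨x₂, hx₂⟩ : ∃ x₂, x₂ * (4 * y ^ 2) = x * (x ^ 3 - 8 * c) :=
    ⟨_, div_mul_cancel₀ _ (by simp [hy])⟩
  obtain ⟨y₂, hy₂⟩ : ∃ y₂, y₂ * (8 * y ^ 3) = x ^ 6 + 20 * c * x ^ 3 - 8 * c ^ 2 :=
    ⟨_, div_mul_cancel₀ _ (by simp [hy])⟩
  obtain ⟨h₂, hQ⟩ := mordell_add_self h hy hx₂ hy₂
  set Q := Point.some x₂ y₂ h₂ with hQdef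
  rw [← hP, ← two_zsmul] at hQ
  have hy' : y₂ ≠ 0 := by
    rintro rfl
    have : Q + Q = 0 := Point.add_self_of_Y_eq (by rw [mordell_negY]; simp)
    have := hmul 4 (by rw [← this, ← hQ]; module)
    omega
  obtain ⟨x₄, hx₄⟩ : ∃ x₄, x₄ * (4 * y₂ ^ 2) = x₂ * (x₂ ^ 3 - 8 * c) :=
    ⟨_, div_mul_cancel₀ _ (by simp [hy'])⟩
  obtain ⟨y₄, hy₄⟩ : ∃ y₄, y₄ * (8 * y₂ ^ 3) = x₂ ^ 6 + 20 * c * x₂ ^ 3 - 8 * c ^ 2 :=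
    ⟨_, div_mul_cancel₀ _ (by simp [hy'])⟩
  obtain ⟨h₄, hR⟩ := mordell_add_self h₂ hy' hx₄ hy₄
  have hxx : x ≠ x₂ := by
    intro hx
    rcases Point.X_eq_iff (h₁ := h) (h₂ := h₂) |>.mp hx with h' | h'
    · have := hmul 1 (by
        rw [← hP, ← hQdef, ← hQ] at h'
        calc (1 : ℤ) • P = (2 : ℤ) • P - P := by module
          _ = 0 := by rw [← h', sub_self])
      omega
    · have := hmul 3 (by
        rw [← hP, ← hQdef, ← hQ] at h'
        calc (3 : ℤ) • P = (2 : ℤ) • P + P := by module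
          _ = 0 := by rw [add_comm, add_eq_zero_iff_eq_neg]; exact h')
      omega
  -- This is `7P = 0` with `Q = 2P`. Comparing `x`-coordinates shows that `x + x₂ + x₄` is the
  -- square of the slope through `P` and `2P`.
  have hsum : P + Q = -(Q + Q) := by
    rw [← hQ, ← add_eq_zero_iff_eq_neg]
    calc P + (2 : ℤ) • P + ((2 : ℤ) • P + (2 : ℤ) • P) = (7 : ℤ) • P := by module
      _ = 0 := by rw [← h7, ← natCast_zsmul]; rfl
  rw [← hQdef] at hR
  rw [hR, hP, hQdef, Point.add_of_X_ne hxx, Point.neg_some, Point.some.injEq] at hsum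
  have hadd := hsum.1
  rw [slope_of_X_ne hxx] at hadd
  simp only [addX, mordellCurve] at hadd
  have hsub : x - x₂ ≠ 0 := sub_ne_zero.mpr hxx
  have hline : (y - y₂) ^ 2 = (x₄ + x + x₂) * (x - x₂) ^ 2 := by
    rw [← hadd]
    field_simp
    ring
  have key := seven_torsion_equation he hx₂ hy₂ hx₄ hline
  field_simp
  linear_combination key

open WeierstrassCurve.Affine in
theorem add_self_delta {F : Type*} [Field F] [CharZero F] [DecidableEq F] {c w z : F}
    (hc : c ≠ 0) (hw : w ^ 2 + w + 1 = 0)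
    (hz : z ^ 6 + z ^ 5 + z ^ 4 + z ^ 3 + z ^ 2 + z + 1 = 0) {x y : F}
    (hx : x ^ 3 = delta₁ w z * c) (hy : y ^ 2 = (delta₁ w z + 1) * c)
    (h : (mordellCurve c).toAffine.Nonsingular x y) :
    ∃ h₂ : (mordellCurve c).toAffine.Nonsingular (x * dblX w z) (y * dblY w z),
      Point.some x y h + Point.some x y h = Point.some _ _ h₂ := by
  have hy0 : y ≠ 0 := by
    rintro rfl
    have := mul_ne_zero (delta_add_one_ne_zero hw hz) hc
    rw [← hy] at this
    norm_num at this
  refine mordell_add_self h hy0 ?_ ?_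
  · linear_combination 4 * x * dblX w z * hy - x * hx - x * c * delta_sub_eight hw hz
  · have h4 : y ^ 4 = ((delta₁ w z + 1) * c) ^ 2 := by rw [← hy]; ring
    linear_combination 8 * dblY w z * h4 - c ^ 2 * delta_sq_add hw hz
      - (x ^ 3 + delta₁ w z * c + 20 * c) * hx

open WeierstrassCurve.Affine in
/-- The points with `x³ = δ₁ c` and `y² = (δ₁ + 1) c` are killed by `7`. -/
theorem seven_smul_eq_zero {F : Type*} [Field F] [CharZero F] [DecidableEq F] {c w z : F}
    (hc : c ≠ 0) (hw : w ^ 2 + w + 1 = 0)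
    (hz : z ^ 6 + z ^ 5 + z ^ 4 + z ^ 3 + z ^ 2 + z + 1 = 0) {x y : F}
    (hx : x ^ 3 = delta₁ w z * c) (hy : y ^ 2 = (delta₁ w z + 1) * c)
    (h : (mordellCurve c).toAffine.Nonsingular x y) :
    7 • Point.some x y h = 0 := by
  have h7 : z ^ 7 = 1 := by linear_combination (z - 1) * hz
  have e2 : (z ^ 4) ^ 4 = z ^ 2 := by linear_combination (z ^ 9 + z ^ 2) * h7
  have hz4 := phi_seven_pow_four hz
  have hz2 := phi_seven_pow_four hz4
  rw [e2] at hz2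
  obtain ⟨h₂, hQ⟩ := add_self_delta hc hw hz hx hy h
  have hx₂ : (x * dblX w z) ^ 3 = delta₁ w (z ^ 4) * c := by
    rw [delta_pow_four hw hz, mul_pow, hx]; ring
  have hy₂ : (y * dblY w z) ^ 2 = (delta₁ w (z ^ 4) + 1) * c := by
    rw [delta_pow_four_add_one hw hz, mul_pow, hy]; ring
  obtain ⟨h₄, hR⟩ := add_self_delta hc hw hz4 hx₂ hy₂ h₂
  have hx₄ : (x * dblX w z * dblX w (z ^ 4)) ^ 3 = delta₁ w (z ^ 2) * c := by
    rw [← e2, delta_pow_four hw hz4, mul_pow, hx₂]; ring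
  have hy₄ : (y * dblY w z * dblY w (z ^ 4)) ^ 2 = (delta₁ w (z ^ 2) + 1) * c := by
    rw [← e2, delta_pow_four_add_one hw hz4, mul_pow, hy₂]; ring
  obtain ⟨h₈, hT⟩ := add_self_delta hc hw hz2 hx₄ hy₄ h₄
  -- The third doubling lands on `P` itself, so `8P = P`.
  have hfin : Point.some _ _ h₈ = Point.some x y h := by
    rw [Point.some.injEq]
    constructor
    · linear_combination x * dblX_mul hw hz
    · linear_combination y * dblY_mul hw hz
  rw [hfin, ← hR, ← hQ] at hT
  set P := Point.some x y h
  calc 7 • P = P + P + (P + P) + (P + P + (P + P)) - P := by module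
    _ = 0 := by rw [hT, sub_self]

theorem primitiveRoot_three_eq {F : Type*} [Field F] {w : F} (h : IsPrimitiveRoot w 3) :
    w ^ 2 + w + 1 = 0 := by
  have := h.geom_sum_eq_zero (by norm_num)
  simp only [Finset.sum_range_succ, Finset.sum_range_zero] at this
  linear_combination this

theorem primitiveRoot_seven_eq {F : Type*} [Field F] {z : F} (h : IsPrimitiveRoot z 7) :
    z ^ 6 + z ^ 5 + z ^ 4 + z ^ 3 + z ^ 2 + z + 1 = 0 := by
  have := h.geom_sum_eq_zero (by norm_num)
  simp only [Finset.sum_range_succ, Finset.sum_range_zero] at this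
  linear_combination this

theorem baseChange_mordellCurve {K : Type*} [Field K] (c : K) (L : Type*) [Field L] [Algebra K L] :
    (mordellCurve c).baseChange L = mordellCurve (algebraMap K L c) := by
  ext <;> simp [mordellCurve]

theorem mem_of_cube_eq {F : Type*} [Field F] {S : Subfield F} {w x y : F}
    (hw : w ^ 2 + w + 1 = 0) (hwS : w ∈ S) (hy : y ∈ S) (h : x ^ 3 = y ^ 3) : x ∈ S := by
  have : (x - y) * ((x - w * y) * (x - w ^ 2 * y)) = 0 := by
    linear_combination h - (x - y) * (x * y - y ^ 2 * (w - 1)) * hw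
  rcases mul_eq_zero.mp this with h | h
  · rwa [sub_eq_zero.mp h]
  · rcases mul_eq_zero.mp h with h | h <;> rw [sub_eq_zero.mp h]
    · exact mul_mem hwS hy
    · exact mul_mem (pow_mem hwS 2) hy

theorem mem_of_sq_eq {F : Type*} [Field F] {S : Subfield F} {x y : F}
    (hy : y ∈ S) (h : x ^ 2 = y ^ 2) : x ∈ S := by
  rcases sq_eq_sq_iff_eq_or_eq_neg.mp h with rfl | rfl
  · exact hy
  · exact neg_mem hy

/-! ### The division field in terms of radicals. -/

section DivisionField

variable {K : Type*} [Field K] {c : K}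

open Classical in
theorem mem_divisionField_seven [CharZero K] (hc : c ≠ 0) {w z x y : AlgebraicClosure K}
    (hw : w ^ 2 + w + 1 = 0)
    (hz : z ^ 6 + z ^ 5 + z ^ 4 + z ^ 3 + z ^ 2 + z + 1 = 0)
    (hx : x ^ 3 = delta₁ w z * algebraMap K _ c)
    (hy : y ^ 2 = (delta₁ w z + 1) * algebraMap K _ c) :
    x ∈ divisionField (mordellCurve c) 7 ∧ y ∈ divisionField (mordellCurve c) 7 := by
  have : CharZero (AlgebraicClosure K) := charZero_of_injective_algebraMap (algebraMap K _).injective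
  have hc' : algebraMap K (AlgebraicClosure K) c ≠ 0 := by simpa using hc
  have key : ∃ h : ((mordellCurve c).baseChange (AlgebraicClosure K)).toAffine.Nonsingular x y,
      7 • WeierstrassCurve.Affine.Point.some x y h = 0 := by
    rw [baseChange_mordellCurve]
    have h := mordell_nonsingular hc' (x := x) (y := y) (by rw [hx, hy]; ring)
    exact ⟨h, seven_smul_eq_zero hc' hw hz hx hy h⟩
  obtain ⟨h, h7⟩ := key
  exact ⟨subset_adjoin _ _ ⟨x, y, h, h7, Or.inl rfl⟩,
    subset_adjoin _ _ ⟨x, y, h, h7, Or.inr rfl⟩⟩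

/-- The description of the `7`-division field of `y² = x³ + c` by radicals. -/
theorem divisionField_seven_eq [CharZero K] (hc : c ≠ 0) {w z r s : AlgebraicClosure K}
    (hw : w ^ 2 + w + 1 = 0)
    (hz : z ^ 6 + z ^ 5 + z ^ 4 + z ^ 3 + z ^ 2 + z + 1 = 0)
    (hr : r ^ 3 = delta₁ w z * algebraMap K _ c)
    (hs : s ^ 2 = (delta₁ w z + 1) * algebraMap K _ c) :
    divisionField (mordellCurve c) 7 = adjoin K {w, z, r, s} := by
  classical
  have : CharZero (AlgebraicClosure K) := charZero_of_injective_algebraMap (algebraMap K _).injective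
  have hc' : algebraMap K (AlgebraicClosure K) c ≠ 0 := by simpa using hc
  apply le_antisymm
  · refine adjoin_le_iff.mpr ?_
    rintro t ⟨x, y, h, h7, ht⟩
    have key : ∃ h : (mordellCurve (algebraMap K (AlgebraicClosure K) c)).toAffine.Nonsingular x y,
        7 • WeierstrassCurve.Affine.Point.some x y h = 0 := by
      rw [← baseChange_mordellCurve]
      exact ⟨h, h7⟩
    obtain ⟨h', h7'⟩ := key
    have he := mordell_equation_iff.mp h'.1
    set S : Subfield (AlgebraicClosure K) := (adjoin K {w, z, r, s}).toSubfield with hS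
    have hwS : w ∈ S := subset_adjoin K {w, z, r, s} (by simp)
    have hzS : z ∈ S := subset_adjoin K {w, z, r, s} (by simp)
    have hrS : r ∈ S := subset_adjoin K {w, z, r, s} (by simp)
    have hsS : s ∈ S := subset_adjoin K {w, z, r, s} (by simp)
    -- With `T = x³ / c`, the factors `a` and `b` exhibit `x` as `r a` up to a cube root of unity
    -- and `y` as `s b` up to sign.
    obtain ⟨a, ha, b, hb, h1, h2⟩ := deltaEquiv_of_root hw hz hwS hzS (torsion_root hc' h' h7')
    have hx : x ^ 3 = (r * a) ^ 3 := by
      rw [div_eq_iff hc'] at h1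
      rw [h1, mul_pow, hr]; ring
    have hy : y ^ 2 = (s * b) ^ 2 := by
      rw [he, mul_pow, hs]
      have : x ^ 3 = x ^ 3 / algebraMap K (AlgebraicClosure K) c * algebraMap K _ c := by
        field_simp
      rw [this]
      linear_combination algebraMap K (AlgebraicClosure K) c * h2
    change t ∈ S
    rcases ht with rfl | rfl
    · exact mem_of_cube_eq hw hwS (mul_mem hrS ha) hx
    · exact mem_of_sq_eq (mul_mem hsS hb) hy
  · set D := divisionField (mordellCurve c) 7 with hD
    have hcD : algebraMap K (AlgebraicClosure K) c ∈ D := D.algebraMap_mem c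
    obtain ⟨hrD, hsD⟩ := mem_divisionField_seven hc hw hz hr hs
    have hw3 : w ^ 3 = 1 := by linear_combination (w - 1) * hw
    -- The point `(w r, s)` is also killed by 7, so `w` is a quotient of two torsion coordinates.
    have hwr := (mem_divisionField_seven hc hw hz (x := w * r)
      (by rw [mul_pow, hw3, hr, one_mul]) hs).1
    have hr0 : r ≠ 0 := by
      rintro rfl
      have := mul_ne_zero (delta_ne_zero hw hz) hc'
      rw [← hr] at this
      norm_num at this
    have hwD : w ∈ D := by
      rw [← mul_div_cancel_right₀ w hr0]
      exact div_mem hwr hrD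
    -- For each primitive seventh root `ξ`, the value `δ₁(w, ξ)` is `x³ / c` for a torsion
    -- coordinate `x`, and `dblX` is a rational function of it.
    have hu : ∀ ξ : AlgebraicClosure K, ξ ^ 6 + ξ ^ 5 + ξ ^ 4 + ξ ^ 3 + ξ ^ 2 + ξ + 1 = 0 →
        dblX w ξ ∈ D := by
      intro ξ hξ
      obtain ⟨x, hx⟩ := IsAlgClosed.exists_pow_nat_eq
        (delta₁ w ξ * algebraMap K (AlgebraicClosure K) c) (n := 3) (by norm_num)
      obtain ⟨y, hy⟩ := IsAlgClosed.exists_pow_nat_eq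
        ((delta₁ w ξ + 1) * algebraMap K (AlgebraicClosure K) c) (n := 2) (by norm_num)
      have hxD := (mem_divisionField_seven hc hw hξ hx hy).1
      have hδ : delta₁ w ξ ∈ D := by
        rw [← mul_div_cancel_right₀ (delta₁ w ξ) hc', ← hx]
        exact div_mem (pow_mem hxD 3) hcD
      have h8 : dblX w ξ = (delta₁ w ξ - 8) / (4 * (delta₁ w ξ + 1)) := by
        have := delta_add_one_ne_zero hw hξ
        rw [delta_sub_eight hw hξ]
        field_simp
      rw [h8]
      exact div_mem (sub_mem hδ (ofNat_mem D 8))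
        (mul_mem (ofNat_mem D 4) (add_mem hδ (one_mem D)))
    have h7 : z ^ 7 = 1 := by linear_combination (z - 1) * hz
    have hz4 := phi_seven_pow_four hz
    have hz2 := phi_seven_pow_four hz4
    have hz6 := phi_seven_pow_six hz
    have hz3 := phi_seven_pow_four hz6
    have hz5 := phi_seven_pow_four hz3
    rw [show (z ^ 4) ^ 4 = z ^ 2 by linear_combination (z ^ 9 + z ^ 2) * h7] at hz2
    rw [show (z ^ 6) ^ 4 = z ^ 3 by linear_combination (z ^ 17 + z ^ 10 + z ^ 3) * h7] at hz3 hz5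
    rw [show (z ^ 3) ^ 4 = z ^ 5 by linear_combination z ^ 5 * h7] at hz5
    have hzD : z ∈ D := by
      have h27 := zeta_eq_sum_dblX hw hz
      rw [mul_comm (27 : AlgebraicClosure K) z, ← eq_div_iff (by norm_num)] at h27
      rw [h27]
      have hm : ∀ a b : ℤ, ∀ u ∈ D, ((a : AlgebraicClosure K) + b * w) * u ∈ D :=
        fun a b u hu ↦ mul_mem (add_mem (intCast_mem D a) (mul_mem (intCast_mem D b) hwD)) hu
      refine div_mem ?_ (ofNat_mem D 27)
      have := add_mem (add_mem (add_mem (add_mem (add_mem (hm (-4) (-2) _ (hu z hz))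
        (hm (-1) 4 _ (hu _ hz2))) (hm 1 (-1) _ (hu _ hz3))) (hm 2 1 _ (hu _ hz4)))
        (hm (-5) (-4) _ (hu _ hz5))) (hm (-2) 2 _ (hu _ hz6))
      push_cast at this
      exact this
    refine adjoin_le_iff.mpr ?_
    rintro t (rfl | rfl | rfl | rfl)
    exacts [hwD, hzD, hrD, hsD]

end DivisionField

/-! ### Degrees of quadratic and cubic steps. -/

section Degrees

open Polynomial

variable {K Ω : Type*} [Field K] [Field Ω] [Algebra K Ω]

open Classical in
/-- Adjoining a root `a` of a monic quadratic or cubic polynomial, whose roots in the base all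
generate `a`, multiplies the degree by `1` or by the degree of the polynomial. -/
theorem finrank_adjoin_insert {S : Set Ω} {a : Ω} {n : ℕ} (hn : n ∈ Finset.Icc 2 3)
    {f : (adjoin K S)[X]} (hf : f.Monic) (hdeg : f.natDegree = n) (ha : aeval a f = 0)
    (hroot : ∀ b ∈ adjoin K S, aeval b f = 0 → a ∈ adjoin K S) :
    Module.finrank K (adjoin K (insert a S))
      = Module.finrank K (adjoin K S) * if a ∈ adjoin K S then 1 else n := by
  have h1 : Module.finrank K (adjoin K (insert a S))
      = Module.finrank K (adjoin K S) * Module.finrank (adjoin K S) (adjoin K S)⟮a⟯ := by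
    rw [Module.finrank_mul_finrank, ← Set.union_singleton, ← adjoin_adjoin_left]
    rfl
  have hint : IsIntegral (adjoin K S) a := ⟨f, hf, by simpa [aeval_def] using ha⟩
  rw [h1, adjoin.finrank hint]
  congr 1
  split_ifs with h
  · rw [minpoly.natDegree_eq_one_iff]
    exact ⟨⟨a, h⟩, rfl⟩
  · have hirr : Irreducible f := by
      have hdeg' : f.natDegree ∈ Finset.Icc 1 3 := by
        rw [hdeg]; exact Finset.Icc_subset_Icc (by norm_num) le_rfl hn
      -- In degree at most 3 a reducible polynomial has a root in the base field, and `hroot` would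
      -- then put `a` there.
      refine irreducible_of_degree_le_three_of_not_isRoot hdeg' fun b hb ↦ h ?_
      refine hroot b b.2 ?_
      have : aeval (algebraMap (adjoin K S) Ω b) f = 0 := by
        rw [aeval_algebraMap_apply_eq_algebraMap_eval, hb.eq_zero, map_zero]
      exact this
    rw [← minpoly.eq_of_irreducible_of_monic hirr ha hf, hdeg]

open Classical in
theorem finrank_adjoin_insert_quadratic {S : Set Ω} {a p q : Ω} (hp : p ∈ adjoin K S)
    (hq : q ∈ adjoin K S) (ha : a ^ 2 + p * a + q = 0) :
    Module.finrank K (adjoin K (insert a S))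
      = Module.finrank K (adjoin K S) * if a ∈ adjoin K S then 1 else 2 := by
  set f : (adjoin K S)[X] := X ^ 2 + C ⟨p, hp⟩ * X + C ⟨q, hq⟩ with hf
  have hev : ∀ b : Ω, aeval b f = b ^ 2 + p * b + q := by
    intro b
    simp only [hf, map_add, map_mul, map_pow, aeval_X, aeval_C]
    rfl
  refine finrank_adjoin_insert (n := 2) (f := f) (by simp) (by rw [hf]; monicity!)
    (by rw [hf]; compute_degree!) (by rw [hev, ha]) fun b hb hb0 ↦ ?_
  rw [hev] at hb0
  have : (a - b) * (a - (-p - b)) = 0 := by linear_combination ha - hb0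
  rcases mul_eq_zero.mp this with h | h <;> rw [sub_eq_zero.mp h]
  · exact hb
  · exact sub_mem (neg_mem hp) hb

open Classical in
theorem finrank_adjoin_insert_cube {S : Set Ω} {a q w : Ω} (hw : w ^ 2 + w + 1 = 0)
    (hwS : w ∈ adjoin K S) (hq : q ∈ adjoin K S) (ha : a ^ 3 = q) :
    Module.finrank K (adjoin K (insert a S))
      = Module.finrank K (adjoin K S) * if a ∈ adjoin K S then 1 else 3 := by
  set f : (adjoin K S)[X] := X ^ 3 - C ⟨q, hq⟩ with hf
  have hev : ∀ b : Ω, aeval b f = b ^ 3 - q := by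
    intro b
    simp only [hf, map_sub, map_pow, aeval_X, aeval_C]
    rfl
  refine finrank_adjoin_insert (n := 3) (f := f) (by simp) (by rw [hf]; monicity!)
    (by rw [hf]; compute_degree!) (by rw [hev, ha, sub_self]) fun b hb hb0 ↦ ?_
  rw [hev] at hb0
  exact mem_of_cube_eq (S := (adjoin K S).toSubfield) hw hwS hb
    (by rw [ha]; linear_combination -hb0)

-- The polynomial is the cubic satisfied by `ζ₇ + ζ₇⁻¹`. It is cyclic: one root generates the
-- others.
open Classical in
theorem finrank_adjoin_insert_cubic {S : Set Ω} {a : Ω} (ha : a ^ 3 + a ^ 2 - 2 * a - 1 = 0) :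
    Module.finrank K (adjoin K (insert a S))
      = Module.finrank K (adjoin K S) * if a ∈ adjoin K S then 1 else 3 := by
  set f : (adjoin K S)[X] := X ^ 3 + X ^ 2 - C 2 * X - C 1 with hf
  have hev : ∀ b : Ω, aeval b f = b ^ 3 + b ^ 2 - 2 * b - 1 := by
    intro b
    simp only [hf, map_add, map_sub, map_mul, map_pow, aeval_X, map_ofNat, map_one]
  refine finrank_adjoin_insert (n := 3) (f := f) (by simp) (by rw [hf]; monicity!)
    (by rw [hf]; compute_degree!) (by rw [hev, ha]) fun b hb hb0 ↦ ?_
  rw [hev] at hb0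
  -- For `b = ζ + ζ⁻¹` the next root is `ζ² + ζ⁻² = b² - 2`, and the third follows from the root sum
  -- `-1`.
  have : (a - b) * ((a - (b ^ 2 - 2)) * (a - (1 - b - b ^ 2))) = 0 := by
    linear_combination ha + (b ^ 2 - a * b - 1) * hb0
  have h2 : (2 : Ω) ∈ adjoin K S := ofNat_mem _ 2
  rcases mul_eq_zero.mp this with h | h
  · rwa [sub_eq_zero.mp h]
  · rcases mul_eq_zero.mp h with h | h <;> rw [sub_eq_zero.mp h]
    · exact sub_mem (pow_mem hb 2) h2
    · exact sub_mem (sub_mem (one_mem _) hb) (pow_mem hb 2)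

end Degrees

/-! ### The five conditions and the table of degrees. -/

section Conditions

theorem ite_eq_ite_swap {P Q : Prop} [Decidable P] [Decidable Q] (h : P ↔ ¬Q) {a b : ℕ} :
    (if P then a else b) = if Q then b else a := by
  by_cases hQ : Q <;> simp [h, hQ]

variable {K : Type*} [Field K]

open Classical in
theorem finrank_adjoin_zeta {w z : AlgebraicClosure K} (hw : w ^ 2 + w + 1 = 0)
    (hz : z ^ 6 + z ^ 5 + z ^ 4 + z ^ 3 + z ^ 2 + z + 1 = 0) :
    Module.finrank K (adjoin K {w, z}) = (if CondA K w then 2 else 1)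
      * (if CondB1 K w z then 3 else 1) * (if CondB2 K w z then 2 else 1) := by
  have hz0 : z ≠ 0 := by
    rintro rfl
    norm_num at hz
  have h7 : z ^ 7 = 1 := by linear_combination (z - 1) * hz
  set η := z + z⁻¹ with hη
  have hzi : z⁻¹ = z ^ 6 := inv_eq_of_mul_eq_one_right (by linear_combination h7)
  have hη6 : η = z + z ^ 6 := by rw [hη, hzi]
  have hηrel : η ^ 3 + η ^ 2 - 2 * η - 1 = 0 := by
    rw [hη6]
    linear_combination (z ^ 11 + z ^ 4 + 3 * z ^ 6 + 3 * z + z ^ 5 + 2) * h7 + hz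
  have h1 := finrank_adjoin_insert_quadratic (K := K) (S := ∅) (a := w) (p := 1) (q := 1)
    (one_mem _) (one_mem _) (by rw [one_mul, hw])
  have h2 := finrank_adjoin_insert_cubic (K := K) (S := {w}) hηrel
  -- `z` is a root of `X² - η X + 1`.
  have h3 := finrank_adjoin_insert_quadratic (K := K) (S := {w, η}) (a := z) (p := -η) (q := 1)
    (neg_mem (subset_adjoin K _ (by simp))) (one_mem _) (by
      rw [hη]; field_simp; ring)
  have hset : adjoin K (insert z {w, η}) = adjoin K {w, z} := by
    apply le_antisymm
    · refine adjoin_le_iff.mpr ?_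
      have hzm : z ∈ adjoin K {w, z} := subset_adjoin K _ (by simp)
      rintro t (rfl | rfl | rfl)
      · exact hzm
      · exact subset_adjoin K _ (by simp)
      · exact add_mem hzm (inv_mem hzm)
    · refine adjoin.mono K _ _ ?_
      rintro t (rfl | rfl) <;> simp
  rw [hset, Set.pair_comm w η, h2] at h3
  rw [Set.pair_comm η w] at h3
  rw [insert_empty_eq, adjoin_empty, IntermediateField.finrank_bot, one_mul] at h1
  rw [h3, h1]
  rw [ite_eq_ite_swap (P := CondA K w) Iff.rfl, ite_eq_ite_swap (P := CondB1 K w z) Iff.rfl,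
    ite_eq_ite_swap (P := CondB2 K w z) Iff.rfl]

open Classical in
theorem finrank_adjoin_radicals {w z r s d e : AlgebraicClosure K}
    (hw : w ^ 2 + w + 1 = 0) (hd : d ∈ adjoin K {w, z}) (he : e ∈ adjoin K {w, z})
    (hr : r ^ 3 = d) (hs : s ^ 2 = e) :
    Module.finrank K (adjoin K {w, z, r, s}) = Module.finrank K (adjoin K {w, z})
      * (if CondC K w z r then 3 else 1) * (if CondD K w z s then 2 else 1) := by
  have hle : ∀ t, adjoin K {w, z} ≤ adjoin K (insert t {w, z}) :=
    fun t ↦ adjoin.mono K _ _ (Set.subset_insert _ _)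
  have hwm : w ∈ adjoin K {w, z} := subset_adjoin K _ (by simp)
  have h1 := finrank_adjoin_insert_cube (K := K) (S := {w, z}) hw hwm hd hr
  have h2 := finrank_adjoin_insert_quadratic (K := K) (S := insert r {w, z}) (a := s) (p := 0)
    (q := -e) (zero_mem _) (neg_mem (hle r he)) (by rw [hs]; ring)
  have h2' := finrank_adjoin_insert_quadratic (K := K) (S := {w, z}) (a := s) (p := 0)
    (q := -e) (zero_mem _) (neg_mem he) (by rw [hs]; ring)
  have hpos : 0 < Module.finrank K (adjoin K {w, z}) := by
    have : FiniteDimensional K (adjoin K {w, z}) :=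
      finiteDimensional_adjoin fun x _ ↦ Algebra.IsIntegral.isIntegral x
    exact Module.finrank_pos
  -- Condition D refers to `K(ζ₃, ζ₇)`, not to the field with `r` adjoined. The two agree because a
  -- quadratic extension does not embed in one of degree 1 or 3.
  have hiff : s ∈ adjoin K (insert r {w, z}) ↔ s ∈ adjoin K {w, z} := by
    refine ⟨fun h ↦ ?_, fun h ↦ hle r h⟩
    by_contra hcon
    rw [if_neg hcon] at h2'
    have hsub : adjoin K (insert s {w, z}) ≤ adjoin K (insert r {w, z}) := by
      refine adjoin_le_iff.mpr (Set.insert_subset h ?_)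
      exact fun t ht ↦ hle r (subset_adjoin K _ ht)
    have hdvd := finrank_dvd_of_le_right hsub
    rw [h2', h1] at hdvd
    have := Nat.dvd_of_mul_dvd_mul_left hpos hdvd
    split_ifs at this <;> omega
  have hset : ({w, z, r, s} : Set (AlgebraicClosure K)) = insert s (insert r {w, z}) := by
    ext t
    simp only [Set.mem_insert_iff, Set.mem_singleton_iff]
    tauto
  rw [hset, h2, h1]
  rw [ite_eq_ite_swap (P := CondC K w z r) Iff.rfl, ite_eq_ite_swap (P := CondD K w z s) Iff.rfl]
  simp only [hiff]

theorem delta_mem {w z : AlgebraicClosure K} : delta₁ w z ∈ adjoin K {w, z} := by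
  obtain ⟨S, hS⟩ : ∃ S, S = adjoin K {w, z} := ⟨_, rfl⟩
  have hw : w ∈ S := hS ▸ subset_adjoin K _ (by simp)
  have hz : z ∈ S := hS ▸ subset_adjoin K _ (by simp)
  rw [← hS]
  clear hS
  lift w to S using hw
  lift z to S using hz
  exact SetLike.coe_mem (delta₁ w z)

open Classical in
theorem finrank_divisionField_seven [CharZero K] {c : K} (hc : c ≠ 0)
    {w z r s : AlgebraicClosure K} (hw : w ^ 2 + w + 1 = 0)
    (hz : z ^ 6 + z ^ 5 + z ^ 4 + z ^ 3 + z ^ 2 + z + 1 = 0)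
    (hr : r ^ 3 = delta₁ w z * algebraMap K _ c)
    (hs : s ^ 2 = (delta₁ w z + 1) * algebraMap K _ c) :
    Module.finrank K (divisionField (mordellCurve c) 7) = Module.finrank K (adjoin K {w, z})
      * (if CondC K w z r then 3 else 1) * (if CondD K w z s then 2 else 1) := by
  rw [divisionField_seven_eq hc hw hz hr hs]
  exact finrank_adjoin_radicals hw (mul_mem delta_mem (IntermediateField.algebraMap_mem _ c))
    (mul_mem (add_mem delta_mem (one_mem _)) (IntermediateField.algebraMap_mem _ c)) hr hs

/-- The exponents of 2 and 3 in `d` count the valid conditions in the groups A, B2, D and B1, C, and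
each row fixes both counts; all 32 truth assignments are checked. -/
theorem degreeTable_of_eq {A B1 B2 C D : Prop} [Decidable A] [Decidable B1] [Decidable B2]
    [Decidable C] [Decidable D] {d : ℕ}
    (hd : d = (if A then 2 else 1) * (if B1 then 3 else 1) * (if B2 then 2 else 1)
      * (if C then 3 else 1) * (if D then 2 else 1)) :
    d ∈ possibleDegrees ∧ DegreeTable A B1 B2 C D d := by
  subst hd
  unfold DegreeTable OneOfTwo OneOfThree TwoOfThree NoneOfThree possibleDegrees
  by_cases A <;> by_cases B1 <;> by_cases B2 <;> by_cases C <;> by_cases D <;> simp [*]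

theorem divisionField_seven_degree [CharZero K] {c : K} (hc : c ≠ 0)
    {ζ₃ ζ₇ r s : AlgebraicClosure K} (h3 : IsPrimitiveRoot ζ₃ 3) (h7 : IsPrimitiveRoot ζ₇ 7)
    (hr : r ^ 3 = delta₁ ζ₃ ζ₇ * algebraMap K (AlgebraicClosure K) c)
    (hs : s ^ 2 = (delta₁ ζ₃ ζ₇ + 1) * algebraMap K (AlgebraicClosure K) c) :
    Module.finrank K (divisionField (mordellCurve c) 7) ∈ possibleDegrees ∧
      DegreeTable (CondA K ζ₃) (CondB1 K ζ₃ ζ₇) (CondB2 K ζ₃ ζ₇) (CondC K ζ₃ ζ₇ r)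
        (CondD K ζ₃ ζ₇ s) (Module.finrank K (divisionField (mordellCurve c) 7)) := by
  classical
  refine degreeTable_of_eq ?_
  have hw := primitiveRoot_three_eq h3
  have hz := primitiveRoot_seven_eq h7
  rw [finrank_divisionField_seven hc hw hz hr hs, finrank_adjoin_zeta hw hz]

end Conditions

/-! ### Realization of the twelve degrees over subfields of `ℚ(ζ₂₁)`. -/

section Existence

open Polynomial

theorem isPrimitiveRoot_nine_mod : IsPrimitiveRoot (9 : ZMod 43) 21 :=
  IsPrimitiveRoot.mk_of_lt 9 (by norm_num) (by decide) (by
    intro l h0 hl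
    interval_cases l <;> decide)

theorem three_ne_pow_mod {n : ℕ} (hn : n = 2 ∨ n = 3) : ∀ v : ZMod 43, v ^ n - 3 ≠ 0 := by
  rcases hn with rfl | rfl <;> decide

theorem coe_mul_pow_three {M : Type*} [Field M] [CharZero M] (K : IntermediateField ℚ M) (x : K)
    (k : ℕ) : ((x * 3 ^ k : K) : M) = x * 3 ^ k := by
  change algebraMap K M (x * 3 ^ k) = algebraMap K M x * 3 ^ k
  rw [map_mul, map_pow, map_ofNat]

theorem coe_784 {M : Type*} [Field M] [CharZero M] (K : IntermediateField ℚ M) :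
    ((784 : K) : M) = 784 :=
  map_ofNat (algebraMap K M) 784

/-- Since `43 ≡ 1` modulo 21, the ring of integers `ℤ[ζ₂₁]` maps to `ZMod 43` by `ζ ↦ 9`. A root of
3 is integral, so it would give a square or cube root of 3 modulo 43, where none exists. -/
theorem cyclotomic_pow_ne_three {M : Type*} [Field M] [CharZero M]
    [IsCyclotomicExtension {21} ℚ M] {n : ℕ} (hn : n = 2 ∨ n = 3) (x : M) : x ^ n ≠ 3 := by
  intro hx
  have : Fact (Nat.Prime 43) := ⟨by norm_num⟩
  have hζ := IsCyclotomicExtension.zeta_spec 21 ℚ M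
  set ζ := IsCyclotomicExtension.zeta 21 ℚ M
  have hn0 : n ≠ 0 := by omega
  have hint : IsIntegral ℤ x := by
    refine IsIntegral.of_pow (Nat.pos_of_ne_zero hn0) ?_
    rw [hx]
    exact (map_ofNat (algebraMap ℤ M) 3) ▸ isIntegral_algebraMap
  obtain ⟨y, hy⟩ := (IsCyclotomicExtension.Rat.isIntegralClosure_adjoin_singleton
    hζ).isIntegral_iff.mp hint
  have hxr : x ∈ Algebra.adjoin ℤ {ζ} := hy ▸ y.2
  rw [Algebra.adjoin_singleton_eq_range_aeval] at hxr
  obtain ⟨P, hP⟩ := hxr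
  have hPx : aeval ζ P = x := hP
  have hdvd : cyclotomic 21 ℤ ∣ P ^ n - 3 := by
    rw [cyclotomic_eq_minpoly hζ (by norm_num)]
    refine minpoly.isIntegrallyClosed_dvd (hζ.isIntegral (by norm_num)) ?_
    simp [hPx, hx, map_ofNat]
  have hroot : (cyclotomic 21 (ZMod 43)).eval 9 = 0 := by
    exact isPrimitiveRoot_nine_mod.isRoot_cyclotomic (by norm_num)
  obtain ⟨Q, hQ⟩ := hdvd
  have h43 := congrArg (fun R : ℤ[X] ↦ (R.map (Int.castRingHom (ZMod 43))).eval 9) hQ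
  simp only [Polynomial.map_sub, Polynomial.map_pow, Polynomial.map_mul, map_cyclotomic, eval_mul,
    hroot, zero_mul, eval_sub, eval_pow, Polynomial.map_ofNat, eval_ofNat] at h43
  generalize (P.map (Int.castRingHom (ZMod 43))).eval 9 = v at h43
  exact three_ne_pow_mod hn v h43

/-- If `e` and `3 e` were both `n`-th powers, so would be their quotient 3. -/
theorem exists_mul_pow_three_ne_pow {M : Type*} [Field M] [CharZero M]
    [IsCyclotomicExtension {21} ℚ M] {n : ℕ} (hn : n = 2 ∨ n = 3) {e : M} (he : e ≠ 0) :
    ∃ a : ℕ, ∀ m : M, m ^ n ≠ e * 3 ^ a := by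
  by_contra! h
  obtain ⟨m₀, h₀⟩ := h 0
  obtain ⟨m₁, h₁⟩ := h 1
  apply cyclotomic_pow_ne_three hn (m₁ / m₀)
  rw [div_pow, h₀, h₁]
  field_simp

/-- If `ζ₃ ∈ K`, the curve has a twist with a point of order `7` over `K`, for which `δ₁ c` is a
cube and `(δ₁ + 1) c` is a square. -/
theorem exists_cube_and_square {M : Type*} [Field M] [CharZero M] {ζ : M} (hζ : IsPrimitiveRoot ζ 21)
    {K : IntermediateField ℚ M} (hK : ζ ^ 7 ∈ K) : ∃ c : K, c ≠ 0 ∧ (∃ m : M, m ^ 3 = delta₁ (ζ ^ 7) (ζ ^ 3) * c) ∧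
      ∃ m : M, m ^ 2 = (delta₁ (ζ ^ 7) (ζ ^ 3) + 1) * c := by
  have hw := primitiveRoot_three_eq (hζ.pow (by norm_num) (show 21 = 7 * 3 by norm_num))
  have hz := primitiveRoot_seven_eq (hζ.pow (by norm_num) (show 21 = 3 * 7 by norm_num))
  have h1 := ram_cube hw hz
  have h2 := ram_sq hw hz
  set t : M := (12 * ζ ^ 7 + 8) / 7 with ht
  have hquad : 7 * t ^ 2 - 4 * t + 16 = 0 := by
    rw [ht]
    linear_combination (144 / 7) * hw
  have htK : t ∈ K := div_mem (add_mem (mul_mem (ofNat_mem K 12) hK) (ofNat_mem K 8)) (ofNat_mem K 7)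
  have ht0 : t ≠ 0 := by
    intro h
    rw [h] at hquad
    norm_num at hquad
  have ht1 : t + 1 ≠ 0 := by
    intro h
    -- The quadratic takes the value `7 + 4 + 16 = 27` at `-1`.
    have : (27 : M) = 0 := by linear_combination hquad - (7 * t - 11) * h
    norm_num at this
  -- The exponents decouple the two requirements: modulo cubes `c` is `t⁻¹`, which cancels `δ₁`, and
  -- modulo squares it is `t + 1`, which matches `δ₁ + 1`. As `t` lies in `ℚ(ζ₃)`, so does `c`.
  refine ⟨⟨t ^ 2 * (t + 1) ^ 3, mul_mem (pow_mem htK 2) (pow_mem (add_mem htK (one_mem K)) 3)⟩,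
    ?_, ⟨delta₁ (ζ ^ 7) (ζ ^ 3) * ramX (ζ ^ 7) (ζ ^ 3) ^ 2 * (t + 1), ?_⟩,
    ⟨t * (t + 1) * (delta₁ (ζ ^ 7) (ζ ^ 3) + 1) * ramY (ζ ^ 7) (ζ ^ 3), ?_⟩⟩
  · intro h
    exact mul_ne_zero (pow_ne_zero 2 ht0) (pow_ne_zero 3 ht1) (congrArg Subtype.val h)
  · simp only
    generalize delta₁ (ζ ^ 7) (ζ ^ 3) = δ at *
    generalize ramX (ζ ^ 7) (ζ ^ 3) = X at *
    linear_combination -δ * (t + 1) ^ 3 * (t + δ * X ^ 3) * h1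
  · simp only
    generalize delta₁ (ζ ^ 7) (ζ ^ 3) = δ at *
    generalize ramY (ζ ^ 7) (ζ ^ 3) = Y at *
    linear_combination -t ^ 2 * (t + 1) ^ 2 * (δ + 1) * h2

variable {M : Type} [Field M] [NumberField M] [IsCyclotomicExtension {21} ℚ M]

theorem adjoin_zeta_three_seven_eq_top {ζ : M} (hζ : IsPrimitiveRoot ζ 21)
    (K : IntermediateField ℚ M) : adjoin K {ζ ^ 7, ζ ^ 3} = ⊤ := by
  have h21 := hζ.pow_eq_one
  have hmem : ζ ∈ adjoin K {ζ ^ 7, ζ ^ 3} := by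
    -- The exponent on the right is `22 ≡ 1` modulo 21.
    have : ζ = ζ ^ 7 * (ζ ^ 3) ^ 5 := by linear_combination -ζ * h21
    have hmem' := mul_mem (subset_adjoin K {ζ ^ 7, ζ ^ 3} (Set.mem_insert _ _))
      (pow_mem (subset_adjoin K {ζ ^ 7, ζ ^ 3} (Set.mem_insert_of_mem _ rfl)) 5)
    rwa [← this] at hmem'
  have htop := IsCyclotomicExtension.adjoin_primitive_root_eq_top (A := ℚ) hζ
  rw [eq_top_iff]
  intro x _
  have hx : x ∈ Algebra.adjoin ℚ {ζ} := htop ▸ Algebra.mem_top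
  have hle : Algebra.adjoin ℚ {ζ}
      ≤ ((adjoin K {ζ ^ 7, ζ ^ 3}).restrictScalars ℚ).toSubalgebra :=
    Algebra.adjoin_le (Set.singleton_subset_iff.mpr hmem)
  exact hle hx

theorem map_delta₁ {A B : Type*} [CommRing A] [CommRing B] (f : A →+* B) (w z : A) :
    f (delta₁ w z) = delta₁ (f w) (f z) := by
  simp only [delta₁, map_neg, map_add, map_sub, map_mul, map_pow, map_ofNat]

-- Under any embedding of `M` over `K`, the image of `M` is `K(ζ₃, ζ₇)`; conditions C and D thus
-- become power conditions in `M` itself.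
open Classical in
theorem finrank_divisionField_of_cyclotomic {ζ : M} (hζ : IsPrimitiveRoot ζ 21)
    (K : IntermediateField ℚ M) (c : K) (hc : c ≠ 0) :
    Module.finrank K (divisionField (mordellCurve c) 7) = Module.finrank K M
      * (if ∃ m : M, m ^ 3 = delta₁ (ζ ^ 7) (ζ ^ 3) * c then 1 else 3)
      * (if ∃ m : M, m ^ 2 = (delta₁ (ζ ^ 7) (ζ ^ 3) + 1) * c then 1 else 2) := by
  obtain ⟨φ⟩ : Nonempty (M →ₐ[K] AlgebraicClosure K) := ⟨IsAlgClosed.lift⟩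
  have hw := primitiveRoot_three_eq (hζ.pow (by norm_num) (show 21 = 7 * 3 by norm_num))
  have hz := primitiveRoot_seven_eq (hζ.pow (by norm_num) (show 21 = 3 * 7 by norm_num))
  have htop := adjoin_zeta_three_seven_eq_top hζ K
  set w := ζ ^ 7
  set z := ζ ^ 3
  have hw' : φ w ^ 2 + φ w + 1 = 0 := by simpa using congrArg φ hw
  have hz' : φ z ^ 6 + φ z ^ 5 + φ z ^ 4 + φ z ^ 3 + φ z ^ 2 + φ z + 1 = 0 := by
    simpa using congrArg φ hz
  have hδ : delta₁ (φ w) (φ z) = φ (delta₁ w z) :=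
    (map_delta₁ (φ : M →+* AlgebraicClosure K) w z).symm
  have hcφ : algebraMap K (AlgebraicClosure K) c = φ c := (φ.commutes c).symm
  obtain ⟨r, hr⟩ := IsAlgClosed.exists_pow_nat_eq
    (delta₁ (φ w) (φ z) * algebraMap K (AlgebraicClosure K) c) (n := 3) (by norm_num)
  obtain ⟨s, hs⟩ := IsAlgClosed.exists_pow_nat_eq
    ((delta₁ (φ w) (φ z) + 1) * algebraMap K (AlgebraicClosure K) c) (n := 2) (by norm_num)
  have hrange : adjoin K {φ w, φ z} = φ.fieldRange := by
    rw [AlgHom.fieldRange_eq_map, ← htop, adjoin_map, Set.image_pair]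
  have hfin : Module.finrank K (adjoin K {φ w, φ z}) = Module.finrank K M := by
    rw [hrange]
    exact (AlgEquiv.ofInjectiveField φ).toLinearEquiv.finrank_eq.symm
  have hr' : CondC K (φ w) (φ z) r ↔ ¬∃ m : M, m ^ 3 = delta₁ w z * c := by
    rw [CondC, hrange, not_iff_not]
    rw [hδ, hcφ, ← map_mul] at hr
    constructor
    · rintro ⟨m, rfl⟩
      exact ⟨m, φ.injective (by rw [map_pow]; exact hr)⟩
    · rintro ⟨m, hm⟩
      exact mem_of_cube_eq (S := φ.fieldRange.toSubfield) hw' ⟨w, rfl⟩ ⟨m, rfl⟩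
        (hr.trans (by rw [← hm, map_pow]; rfl))
  have hs' : CondD K (φ w) (φ z) s ↔ ¬∃ m : M, m ^ 2 = (delta₁ w z + 1) * c := by
    rw [CondD, hrange, not_iff_not]
    rw [hδ, hcφ, ← map_one φ, ← map_add, ← map_mul] at hs
    constructor
    · rintro ⟨m, rfl⟩
      exact ⟨m, φ.injective (by rw [map_pow]; exact hs)⟩
    · rintro ⟨m, hm⟩
      exact mem_of_sq_eq (S := φ.fieldRange.toSubfield) ⟨m, rfl⟩
        (hs.trans (by rw [← hm, map_pow]; rfl))
  rw [finrank_divisionField_seven hc hw' hz' hr hs, hfin, ite_eq_ite_swap hr', ite_eq_ite_swap hs']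


/-- Twists by powers of `3` make `δ₁ c` a non-cube and `(δ₁ + 1) c` a non-square. -/
theorem exists_finrank_eq_mul_six (K : IntermediateField ℚ M) :
    ∃ c : K, c ≠ 0 ∧ Module.finrank K (divisionField (mordellCurve c) 7)
      = Module.finrank K M * 6 := by
  have hζ := IsCyclotomicExtension.zeta_spec 21 ℚ M
  set ζ := IsCyclotomicExtension.zeta 21 ℚ M
  have hw := primitiveRoot_three_eq (hζ.pow (by norm_num) (show 21 = 7 * 3 by norm_num))
  have hz := primitiveRoot_seven_eq (hζ.pow (by norm_num) (show 21 = 3 * 7 by norm_num))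
  obtain ⟨a, ha⟩ := exists_mul_pow_three_ne_pow (Or.inr rfl) (delta_ne_zero hw hz)
  obtain ⟨b, hb⟩ := exists_mul_pow_three_ne_pow (Or.inl rfl) (delta_add_one_ne_zero hw hz)
  -- The exponent is congruent to `a` modulo 3 and to `b` modulo 2.
  refine ⟨1 * 3 ^ (4 * a + 3 * b), by simp, ?_⟩
  rw [finrank_divisionField_of_cyclotomic hζ K _ (by simp), if_neg, if_neg, mul_assoc]
  · norm_num
  · rintro ⟨m, hm⟩
    apply hb (m / (3 ^ (2 * a + b)))
    rw [div_pow, hm, coe_mul_pow_three, OneMemClass.coe_one]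
    field_simp
    ring
  · rintro ⟨m, hm⟩
    apply ha (m / (3 ^ (a + b)))
    rw [div_pow, hm, coe_mul_pow_three, OneMemClass.coe_one]
    field_simp
    ring

/-- For `c = 784 * 3 ^ (3 * b)` the number `δ₁ c` is a cube. -/
theorem exists_finrank_eq_mul_two (K : IntermediateField ℚ M) :
    ∃ c : K, c ≠ 0 ∧ Module.finrank K (divisionField (mordellCurve c) 7)
      = Module.finrank K M * 2 := by
  have hζ := IsCyclotomicExtension.zeta_spec 21 ℚ M
  set ζ := IsCyclotomicExtension.zeta 21 ℚ M
  have hw := primitiveRoot_three_eq (hζ.pow (by norm_num) (show 21 = 7 * 3 by norm_num))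
  have hz := primitiveRoot_seven_eq (hζ.pow (by norm_num) (show 21 = 3 * 7 by norm_num))
  obtain ⟨b, hb⟩ := exists_mul_pow_three_ne_pow (Or.inl rfl) (delta_add_one_ne_zero hw hz)
  -- `784 = 28²` leaves square classes unchanged. Also `784 = 343 * (16 / 7)`, where `16 / 7` is the
  -- product of the roots of the quadratic factor, which is `δ₁²` times a cube; so `784 δ₁` is a
  -- cube.
  refine ⟨784 * 3 ^ (3 * b), by simp, ?_⟩
  rw [finrank_divisionField_of_cyclotomic hζ K _ (by simp), if_pos, if_neg, mul_one]
  · rintro ⟨m, hm⟩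
    apply hb (m / (28 * 3 ^ b))
    rw [div_pow, hm, coe_mul_pow_three, coe_784]
    field_simp
    ring
  · refine ⟨7 * delta₁ (ζ ^ 7) (ζ ^ 3) * ramX (ζ ^ 7) (ζ ^ 3) * ramX' (ζ ^ 7) (ζ ^ 3) * 3 ^ b, ?_⟩
    have h1 := ram_cube hw hz
    have h2 := ram'_cube hw hz
    rw [coe_mul_pow_three, coe_784]
    generalize delta₁ (ζ ^ 7) (ζ ^ 3) = δ at *
    generalize ramX (ζ ^ 7) (ζ ^ 3) = X at *
    generalize ramX' (ζ ^ 7) (ζ ^ 3) = X' at *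
    calc _ = 343 * δ * (δ * X ^ 3) * (δ * X' ^ 3) * (3 ^ b) ^ 3 := by ring
      _ = _ := by
        rw [← h1, ← h2]
        linear_combination (-1008 * δ * (3 ^ b) ^ 3) * hw

theorem exists_finrank_eq_mul_three {ζ : M} (hζ : IsPrimitiveRoot ζ 21)
    {K : IntermediateField ℚ M} (hK : ζ ^ 7 ∈ K) :
    ∃ c : K, c ≠ 0 ∧ Module.finrank K (divisionField (mordellCurve c) 7)
      = Module.finrank K M * 3 := by
  obtain ⟨c, hc, ⟨m, hm⟩, ⟨n, hn⟩⟩ := exists_cube_and_square hζ hK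
  -- `3 ^ 4` is a square, but modulo cubes it is 3.
  refine ⟨c * 3 ^ 4, mul_ne_zero hc (pow_ne_zero _ three_ne_zero), ?_⟩
  rw [finrank_divisionField_of_cyclotomic hζ K _ (mul_ne_zero hc (pow_ne_zero _ three_ne_zero)), if_neg,
    if_pos, mul_one]
  · refine ⟨n * 9, ?_⟩
    rw [coe_mul_pow_three]
    linear_combination 81 * hn
  · rintro ⟨m', hm'⟩
    rw [coe_mul_pow_three] at hm'
    have hw := primitiveRoot_three_eq (hζ.pow (by norm_num) (show 21 = 7 * 3 by norm_num))
    have hz := primitiveRoot_seven_eq (hζ.pow (by norm_num) (show 21 = 3 * 7 by norm_num))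
    have h0 : delta₁ (ζ ^ 7) (ζ ^ 3) * (c : M) ≠ 0 :=
      mul_ne_zero (delta_ne_zero hw hz) (by simpa using hc)
    rw [← mul_assoc, ← hm] at hm'
    have hm0 : m ≠ 0 := by
      rintro rfl
      exact h0 (by rw [← hm]; norm_num)
    apply cyclotomic_pow_ne_three (M := M) (Or.inr rfl) (m' / (m * 3))
    rw [div_pow, hm']
    field_simp

theorem exists_finrank_eq {ζ : M} (hζ : IsPrimitiveRoot ζ 21)
    {K : IntermediateField ℚ M} (hK : ζ ^ 7 ∈ K) :
    ∃ c : K, c ≠ 0 ∧ Module.finrank K (divisionField (mordellCurve c) 7)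
      = Module.finrank K M := by
  obtain ⟨c, hc, hm, hn⟩ := exists_cube_and_square hζ hK
  refine ⟨c, hc, ?_⟩
  rw [finrank_divisionField_of_cyclotomic hζ K _ hc, if_pos hm, if_pos hn, mul_one, mul_one]

theorem card_gal_cyclotomic_twentyone : Nat.card Gal(M/ℚ) = 12 := by
  have : IsGalois ℚ M := IsCyclotomicExtension.isGalois {21} ℚ M
  rw [IsGalois.card_aut_eq_finrank,
    IsCyclotomicExtension.finrank (n := 21) M (cyclotomic.irreducible_rat (by norm_num))]
  decide

theorem exists_subgroup_card_gal {n : ℕ} (hn : n ∈ ({12, 6, 4, 3, 2, 1} : Finset ℕ)) :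
    ∃ H : Subgroup Gal(M/ℚ), Nat.card H = n := by
  have hcard := card_gal_cyclotomic_twentyone (M := M)
  have hpp : ∀ p k : ℕ, p.Prime → p ^ k ∣ 12 → ∃ H : Subgroup Gal(M/ℚ), Nat.card H = p ^ k := by
    intro p k hp hpk
    have : Fact p.Prime := ⟨hp⟩
    exact Sylow.exists_subgroup_card_pow_prime p (by rwa [hcard])
  simp only [Finset.mem_insert, Finset.mem_singleton] at hn
  rcases hn with rfl | rfl | rfl | rfl | rfl | rfl
  · exact ⟨⊤, by rw [Subgroup.card_top, hcard]⟩
  -- 6 is not a prime power, so Sylow does not apply; in the abelian Galois group, the product of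
  -- elements of orders 2 and 3 has order 6.
  · have : Fact (Nat.Prime 2) := ⟨by norm_num⟩
    have : Fact (Nat.Prime 3) := ⟨by norm_num⟩
    obtain ⟨g, hg⟩ := exists_prime_orderOf_dvd_card' (G := Gal(M/ℚ)) 2 (by rw [hcard]; norm_num)
    obtain ⟨h, hh⟩ := exists_prime_orderOf_dvd_card' (G := Gal(M/ℚ)) 3 (by rw [hcard]; norm_num)
    have hcomm : Commute g h := by
      have := IsCyclotomicExtension.isMulCommutative {21} ℚ M
      exact mul_comm' g h
    refine ⟨Subgroup.zpowers (g * h), ?_⟩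
    rw [Nat.card_zpowers, hcomm.orderOf_mul_eq_mul_orderOf_of_coprime (by rw [hg, hh]; norm_num),
      hg, hh]
  · exact hpp 2 2 (by norm_num) (by norm_num)
  · exact hpp 3 1 (by norm_num) (by norm_num)
  · exact hpp 2 1 (by norm_num) (by norm_num)
  · exact ⟨⊥, Subgroup.card_bot⟩

theorem exists_intermediateField_finrank {n : ℕ} (hn : n ∈ ({12, 6, 4, 3, 2, 1} : Finset ℕ)) :
    ∃ K : IntermediateField ℚ M, Module.finrank K M = n := by
  obtain ⟨H, hH⟩ := exists_subgroup_card_gal (M := M) hn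
  exact ⟨fixedField H, by rw [finrank_fixedField_eq_card, hH]⟩

/-- A subfield over which `ℚ(ζ₂₁)` has degree `3` contains the cube roots of unity. -/
theorem exists_intermediateField_finrank_three {ζ : M} (hζ : IsPrimitiveRoot ζ 21) :
    ∃ K : IntermediateField ℚ M, Module.finrank K M = 3 ∧ ζ ^ 7 ∈ K := by
  obtain ⟨H, hH⟩ := exists_subgroup_card_gal (M := M) (n := 3) (by simp)
  refine ⟨fixedField H, by rw [finrank_fixedField_eq_card, hH], ?_⟩
  rw [mem_fixedField_iff]
  intro σ hσ
  have hw3 := hζ.pow (by norm_num) (show 21 = 7 * 3 by norm_num)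
  have hw := primitiveRoot_three_eq hw3
  set w := ζ ^ 7
  -- `σ` has order dividing 3, whereas it can only fix or swap `w` and `w²`; so it fixes them.
  have hσ3 : σ ^ 3 = 1 := by
    have := pow_card_eq_one' (x := (⟨σ, hσ⟩ : H))
    rw [hH] at this
    exact congrArg Subtype.val this
  have hσw : σ w ^ 2 + σ w + 1 = 0 := by simpa using congrArg σ hw
  have hor : (σ w - w) * (σ w - w ^ 2) = 0 := by
    linear_combination hσw - (σ w - w + 1) * hw
  rcases mul_eq_zero.mp hor with h | h
  · exact sub_eq_zero.mp h
  · exfalso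
    have h' : σ w = w ^ 2 := sub_eq_zero.mp h
    have h3 : σ (σ (σ w)) = w := by
      have := DFunLike.congr_fun hσ3 w
      simpa [pow_succ] using this
    simp only [h', map_pow] at h3
    have hw1 : w ^ 3 = 1 := hw3.pow_eq_one
    have : w = 1 := by
      have hsq : w ^ 2 = w := by linear_combination h3 - (w ^ 5 + w ^ 2) * hw1
      have := hw3.ne_zero (by norm_num)
      exact mul_left_cancel₀ this (by linear_combination hsq)
    rw [this] at hw
    norm_num at hw

theorem exists_divisionField_seven_degree (d : ℕ) (hd : d ∈ possibleDegrees) :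
    ∃ (K : Type) (_ : Field K) (_ : NumberField K) (c : K),
      c ≠ 0 ∧ Module.finrank K (divisionField (mordellCurve c) 7) = d := by
  have : NeZero ((21 : ℕ) : ℚ) := ⟨by norm_num⟩
  have : IsCyclotomicExtension {21} ℚ (CyclotomicField 21 ℚ) :=
    CyclotomicField.isCyclotomicExtension 21 ℚ
  have hζ := IsCyclotomicExtension.zeta_spec 21 ℚ (CyclotomicField 21 ℚ)
  have six : ∀ n ∈ ({12, 6, 4, 3, 2, 1} : Finset ℕ), n * 6 = d →
      ∃ (K : Type) (_ : Field K) (_ : NumberField K) (c : K),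
        c ≠ 0 ∧ Module.finrank K (divisionField (mordellCurve c) 7) = d := by
    rintro n hn rfl
    obtain ⟨K, hK⟩ := exists_intermediateField_finrank (M := CyclotomicField 21 ℚ) hn
    obtain ⟨c, hc, h⟩ := exists_finrank_eq_mul_six K
    exact ⟨K, inferInstance, inferInstance, c, hc, by rw [h, hK]⟩
  have two : ∀ n ∈ ({12, 6, 4, 3, 2, 1} : Finset ℕ), n * 2 = d →
      ∃ (K : Type) (_ : Field K) (_ : NumberField K) (c : K),
        c ≠ 0 ∧ Module.finrank K (divisionField (mordellCurve c) 7) = d := by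
    rintro n hn rfl
    obtain ⟨K, hK⟩ := exists_intermediateField_finrank (M := CyclotomicField 21 ℚ) hn
    obtain ⟨c, hc, h⟩ := exists_finrank_eq_mul_two K
    exact ⟨K, inferInstance, inferInstance, c, hc, by rw [h, hK]⟩
  simp only [possibleDegrees, Finset.mem_insert, Finset.mem_singleton] at hd
  -- The degrees 9 and 3 need `[ℚ(ζ₂₁) : K] = 3` and no factor 2 from the square root, hence the
  -- choice of `c` that requires `ζ₃ ∈ K`; degree 1 takes `K = ℚ(ζ₂₁)`.
  rcases hd with rfl | rfl | rfl | rfl | rfl | rfl | rfl | rfl | rfl | rfl | rfl | rfl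
  · exact six 12 (by simp) rfl
  · exact six 6 (by simp) rfl
  · exact six 4 (by simp) rfl
  · exact six 3 (by simp) rfl
  · exact six 2 (by simp) rfl
  · obtain ⟨K, hK, hwK⟩ := exists_intermediateField_finrank_three hζ
    obtain ⟨c, hc, h⟩ := exists_finrank_eq_mul_three hζ hwK
    exact ⟨K, inferInstance, inferInstance, c, hc, by rw [h, hK]⟩
  · exact two 4 (by simp) rfl
  · exact six 1 (by simp) rfl
  · exact two 2 (by simp) rfl
  · obtain ⟨K, hK, hwK⟩ := exists_intermediateField_finrank_three hζ
    obtain ⟨c, hc, h⟩ := exists_finrank_eq hζ hwK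
    exact ⟨K, inferInstance, inferInstance, c, hc, by rw [h, hK]⟩
  · exact two 1 (by simp) rfl
  · obtain ⟨c, hc, h⟩ := exists_finrank_eq hζ (K := ⊤) mem_top
    exact ⟨(⊤ : IntermediateField ℚ (CyclotomicField 21 ℚ)), inferInstance, inferInstance, c, hc, by
      rw [h, IntermediateField.finrank_top]⟩

end Existence

end

theorem theorem5 :
    (∀ (K : Type*) [Field K] [NumberField K] (c : K) (_ : c ≠ 0)
      (ζ₃ ζ₇ r s : AlgebraicClosure K)
      (_ : IsPrimitiveRoot ζ₃ 3) (_ : IsPrimitiveRoot ζ₇ 7)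
      (_ : r ^ 3 = delta₁ ζ₃ ζ₇ * algebraMap K (AlgebraicClosure K) c)
      (_ : s ^ 2 = (delta₁ ζ₃ ζ₇ + 1) * algebraMap K (AlgebraicClosure K) c),
      Module.finrank K (divisionField (mordellCurve c) 7) ∈ possibleDegrees ∧
      DegreeTable (CondA K ζ₃) (CondB1 K ζ₃ ζ₇) (CondB2 K ζ₃ ζ₇) (CondC K ζ₃ ζ₇ r)
        (CondD K ζ₃ ζ₇ s) (Module.finrank K (divisionField (mordellCurve c) 7))) ∧
    (∀ d ∈ possibleDegrees, ∃ (K : Type) (_ : Field K) (_ : NumberField K) (c : K),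
      c ≠ 0 ∧ Module.finrank K (divisionField (mordellCurve c) 7) = d) := by
  refine ⟨?_, exists_divisionField_seven_degree⟩
  intro K _ _ c hc ζ₃ ζ₇ r s h3 h7 hr hs
  exact divisionField_seven_degree hc h3 h7 hr hs
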